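/- **The Classic Cauchy–Crofton Formula.** Let $n \ge 1$. *Hypersurfaces.* A smooth graph hypersurface in $\mathbb R^n$ is a set $\{x + f(x)v \mid x \in K\}$, where $v\in S^{n-1}$ is a unit vector, $K$ is a bounded subset of $v^\perp$ that is either open or the closure of an open subset of $v^\perp$ (a graph with boundary), and $f$ is a real-valued $C^\infty$ function on a neighbourhood of $K$ in $v^\perp$. A hypersurface $\Sigma\subset\mathbb R^n$ is a finite union of smooth graph hypersurfaces, and $A(\Sigma)\in[0,\infty]$ denotes its $(n-1)$-dimensional area (the $(n-1)$-dimensional Hausdorff measure of the point set $\Sigma$, normalized to agree with Lebesgue measure on $(n-1)$-dimensional Euclidean spaces). *Lines.* Let $\mathbf L^n$ be the space of oriented lines in $\mathbb R^n$, that is, of pairs $\ell=(v,p)$ with $v\in S^{n-1}$ and $p\in v^\perp$, where $(v,p)$ stands for the line $t\mapsto tv+p$. The kinematic measure $\mu$ on $\mathbf L^n$ is given by $$\int_{\mathbf L^n} F\,d\mu=\int_{S^{n-1}}\Big(\int_{v^\perp}F(v,p)\,dp\Big)\,d\sigma(v),$$ where $\sigma$ is the usual area measure of $S^{n-1}$ and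 $dp$ is Lebesgue measure on $v^\perp$. *Counting.* A line $\ell=(v,p)$ is transverse to $\Sigma$ if, wherever $\ell$ meets one of the graphs forming $\Sigma$, the vector $v$ and the tangent space of that graph at the point together span $\mathbb R^n$. Let $\#(\ell\cap\Sigma)\in\{0,1,2,\dots,\infty\}$ be the number of points of $\ell\cap\Sigma$ if $\ell$ is transverse to $\Sigma$, and $0$ if $\ell$ does not meet $\Sigma$ or meets it non-transversally. If $\Sigma$ is a compact hypersurface in $\mathbb R^n$, then $\ell\mapsto\#(\ell\cap\Sigma)$ is $\mu$-measurable and $$A(\Sigma)=\frac{1}{2\kappa_{n-1}}\int_{\mathbf L^n}\#(\ell\cap\Sigma)\,d\mu(\ell),$$ where $\kappa_{n-1}$ is the volume of the unit ball in $\mathbb R^{n-1}$ (so $\kappa_0=1$). -/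

import Mathlib

open MeasureTheory Set Metric
open scoped ENNReal ContDiff

noncomputable section

namespace Crofton

/-- Oriented lines in `ℝⁿ`: the pairs `(v, p)` with `v` in the unit sphere and `p ⟂ v`; the pair
stands for the line `t ↦ t v + p`, oriented by `v`, whose point nearest to the origin is `p`. -/
abbrev OrientedLine (n : ℕ) : Type :=
  {q : sphere (0 : EuclideanSpace ℝ (Fin n)) 1 × EuclideanSpace ℝ (Fin n) //
    inner ℝ (q.1 : EuclideanSpace ℝ (Fin n)) q.2 = 0}

namespace OrientedLine

variable {n : ℕ}

/-- The unit direction vector `v` of the line `(v, p)`. -/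
def dir (l : OrientedLine n) : EuclideanSpace ℝ (Fin n) := l.1.1

/-- The foot point `p` of the line `(v, p)`. -/
def foot (l : OrientedLine n) : EuclideanSpace ℝ (Fin n) := l.1.2

/-- The set of points of the line. -/
def points (l : OrientedLine n) : Set (EuclideanSpace ℝ (Fin n)) :=
  range fun t : ℝ => t • l.dir + l.foot

/-- The line `(v, p)`, for `v` in the sphere and `p` in the hyperplane `v^⊥`. -/
def mk' (v : sphere (0 : EuclideanSpace ℝ (Fin n)) 1)
    (p : (Submodule.span ℝ {(v : EuclideanSpace ℝ (Fin n))})ᗮ) : OrientedLine n :=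
  ⟨(v, (p : EuclideanSpace ℝ (Fin n))), Submodule.mem_orthogonal_singleton_iff_inner_right.1 p.2⟩

end OrientedLine

/-- Kinematic measure on the space of oriented lines:
`∫ f dμ = ∫_{v ∈ S^{n-1}} (∫_{p ∈ v^⊥} f (v, p) dp) dσ(v)`, where `σ` is the area measure of the
unit sphere and `dp` is Lebesgue measure on the Euclidean space `v^⊥`
(see `lintegral_kinematicMeasure`). -/
def kinematicMeasure (n : ℕ) : Measure (OrientedLine n) :=
  (volume : Measure (EuclideanSpace ℝ (Fin n))).toSphere.bind fun v =>
    (volume : Measure (Submodule.span ℝ {(v : EuclideanSpace ℝ (Fin n))})ᗮ).map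
      (OrientedLine.mk' v)

theorem measurable_map_mk' (n : ℕ) :
    Measurable fun v : sphere (0 : EuclideanSpace ℝ (Fin n)) 1 =>
      (volume : Measure (Submodule.span ℝ {(v : EuclideanSpace ℝ (Fin n))})ᗮ).map
        (OrientedLine.mk' v) := by
  have hmk : ∀ v : sphere (0 : EuclideanSpace ℝ (Fin n)) 1, Measurable (OrientedLine.mk' v) :=
    fun v => (measurable_const.prodMk measurable_subtype_coe).subtype_mk
  have hv1 : ∀ v : sphere (0 : EuclideanSpace ℝ (Fin n)) 1,
      ‖(v : EuclideanSpace ℝ (Fin n))‖ = 1 := fun v => by simp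
  let g : sphere (0 : EuclideanSpace ℝ (Fin n)) 1 × EuclideanSpace ℝ (Fin n) → OrientedLine n :=
    fun q => ⟨(q.1, q.2 - inner ℝ (q.1 : EuclideanSpace ℝ (Fin n)) q.2 •
      (q.1 : EuclideanSpace ℝ (Fin n))), by
        simp [inner_sub_right, inner_smul_right, hv1]⟩
  have hg : Measurable g := by
    refine Measurable.subtype_mk (Continuous.measurable ?_)
    fun_prop
  rw [Measure.measurable_measure]
  intro s hs
  let B : Set (sphere (0 : EuclideanSpace ℝ (Fin n)) 1 × EuclideanSpace ℝ (Fin n)) :=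
    {q | inner ℝ (q.1 : EuclideanSpace ℝ (Fin n)) q.2 ∈ Icc (0 : ℝ) 1} ∩ g ⁻¹' s
  have hB : MeasurableSet B := by
    refine MeasurableSet.inter ?_ (hg hs)
    exact (Continuous.measurable (by fun_prop)) measurableSet_Icc
  have key : (fun v : sphere (0 : EuclideanSpace ℝ (Fin n)) 1 =>
      (volume : Measure (Submodule.span ℝ {(v : EuclideanSpace ℝ (Fin n))})ᗮ).map
        (OrientedLine.mk' v) s) =
      fun v => (volume : Measure (EuclideanSpace ℝ (Fin n))) (Prod.mk v ⁻¹' B) := by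
    funext v
    rw [Measure.map_apply (hmk v) hs]
    set K : Submodule ℝ (EuclideanSpace ℝ (Fin n)) :=
      Submodule.span ℝ {(v : EuclideanSpace ℝ (Fin n))} with hK
    let T : Set K := {k | inner ℝ (v : EuclideanSpace ℝ (Fin n)) (k : EuclideanSpace ℝ (Fin n)) ∈
      Icc (0 : ℝ) 1}
    have hT : MeasurableSet T := by
      refine (Continuous.measurable (?_ : Continuous fun k : K =>
        inner ℝ (v : EuclideanSpace ℝ (Fin n)) (k : EuclideanSpace ℝ (Fin n)))) measurableSet_Icc
      fun_prop
    have hT1 : volume T = 1 := by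
      have e := (LinearIsometryEquiv.toSpanUnitSingleton (𝕜 := ℝ)
        (v : EuclideanSpace ℝ (Fin n)) (hv1 v)).measurePreserving
      have h := e.measure_preimage hT.nullMeasurableSet
      rw [← h]
      have : (LinearIsometryEquiv.toSpanUnitSingleton (𝕜 := ℝ)
        (v : EuclideanSpace ℝ (Fin n)) (hv1 v)) ⁻¹' T = Icc (0 : ℝ) 1 := by
        ext t
        change inner ℝ (v : EuclideanSpace ℝ (Fin n)) (t • (v : EuclideanSpace ℝ (Fin n))) ∈
          Icc (0 : ℝ) 1 ↔ _
        simp [inner_smul_right, hv1]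
      rw [this]
      simp
    have hP : MeasurePreserving (fun x : EuclideanSpace ℝ (Fin n) =>
        WithLp.ofLp (K.orthogonalDecomposition x)) :=
      (WithLp.volume_preserving_ofLp K Kᗮ).comp K.orthogonalDecomposition.measurePreserving
    have h := hP.measure_preimage (s := T ×ˢ (OrientedLine.mk' v ⁻¹' s))
      (hT.prod (hmk v hs)).nullMeasurableSet
    rw [Measure.volume_eq_prod, Measure.prod_prod, hT1, one_mul] at h
    rw [← h]
    congr 1
    ext x
    have h1 : ((K.orthogonalProjectionOnto x : K) : EuclideanSpace ℝ (Fin n)) =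
        inner ℝ (v : EuclideanSpace ℝ (Fin n)) x • (v : EuclideanSpace ℝ (Fin n)) := by
      simp [hK, Submodule.starProjection_unit_singleton ℝ (hv1 v)]
    have h2 : OrientedLine.mk' v (Kᗮ.orthogonalProjectionOnto x) = g (v, x) := by
      apply Subtype.ext
      apply Prod.ext
      · rfl
      · have := K.starProjection_add_starProjection_orthogonal x
        simp only [OrientedLine.mk', g]
        rw [← h1]
        simp only [Submodule.coe_orthogonalProjectionOnto_apply]
        exact eq_sub_of_add_eq' this
    simp only [mem_preimage, mem_prod, Submodule.orthogonalDecomposition_apply, T, Set.mem_ofPred_eq, B,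
      mem_inter_iff, h2, h1, inner_smul_right, real_inner_self_eq_norm_sq, hv1]
    simp
  rw [key]
  exact measurable_measure_prodMk_left hB

/-- Integration against kinematic measure is the iterated integral over directions and feet. -/
theorem lintegral_kinematicMeasure (n : ℕ) {F : OrientedLine n → ℝ≥0∞} (hF : Measurable F) :
    ∫⁻ l, F l ∂(kinematicMeasure n) =
      ∫⁻ v, ∫⁻ p, F (OrientedLine.mk' v p) ∂volume
        ∂(volume : Measure (EuclideanSpace ℝ (Fin n))).toSphere := by
  rw [kinematicMeasure, Measure.lintegral_bind (measurable_map_mk' n).aemeasurable hF.aemeasurable]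
  refine lintegral_congr fun v => ?_
  exact lintegral_map hF (measurable_const.prodMk measurable_subtype_coe).subtype_mk

/-- A smooth graph hypersurface `{x + f(x) v | x ∈ dom}` in `ℝⁿ`, for a unit vector `v` and a
smooth `f`. Its domain is a bounded subset of `v^⊥` which is either open, or the closure of an open
set (a graph with boundary). In both cases `f` is smooth on a neighbourhood of the domain, which for
an open domain just says that `f` is smooth on it. -/
structure GraphHypersurface (n : ℕ) where
  /-- the unit vector `v` -/
  axis : sphere (0 : EuclideanSpace ℝ (Fin n)) 1
  /-- the domain, a subset of `v^⊥` -/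
  dom : Set (Submodule.span ℝ {(axis : EuclideanSpace ℝ (Fin n))})ᗮ
  /-- the function `f` -/
  height : (Submodule.span ℝ {(axis : EuclideanSpace ℝ (Fin n))})ᗮ → ℝ
  isBounded_dom : Bornology.IsBounded dom
  isOpen_or_closure : IsOpen dom ∨ ∃ D, IsOpen D ∧ dom = closure D
  smooth : ∃ U, IsOpen U ∧ dom ⊆ U ∧ ContDiffOn ℝ ∞ height U

namespace GraphHypersurface

variable {n : ℕ} (G : GraphHypersurface n)

/-- The parametrization `x ↦ x + f(x) v`. -/
def param (x : (Submodule.span ℝ {(G.axis : EuclideanSpace ℝ (Fin n))})ᗮ) :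
    EuclideanSpace ℝ (Fin n) :=
  (x : EuclideanSpace ℝ (Fin n)) + G.height x • (G.axis : EuclideanSpace ℝ (Fin n))

/-- The set of points of the graph. -/
def carrier : Set (EuclideanSpace ℝ (Fin n)) := G.param '' G.dom

/-- The tangent space of the graph at the point `x + f(x) v`, as a linear subspace of `ℝⁿ`. -/
def tangentSpace (x : (Submodule.span ℝ {(G.axis : EuclideanSpace ℝ (Fin n))})ᗮ) :
    Submodule ℝ (EuclideanSpace ℝ (Fin n)) :=
  LinearMap.range (fderiv ℝ G.param x).toLinearMap

/-- The line `l` is transverse to the graph: wherever it meets the graph, its direction and the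
tangent space of the graph together span `ℝⁿ`. -/
def IsTransverse (l : OrientedLine n) : Prop :=
  ∀ x ∈ G.dom, G.param x ∈ l.points → Submodule.span ℝ {l.dir} ⊔ G.tangentSpace x = ⊤

end GraphHypersurface

/-- A hypersurface in `ℝⁿ`: a finite union of smooth graph hypersurfaces, some possibly with
boundary. The pieces may overlap or cross. -/
structure Hypersurface (n : ℕ) where
  /-- the number of pieces -/
  numPieces : ℕ
  /-- the pieces -/
  piece : Fin numPieces → GraphHypersurface n

namespace Hypersurface

variable {n : ℕ} (S : Hypersurface n)

/-- The point set of the hypersurface. -/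
def carrier : Set (EuclideanSpace ℝ (Fin n)) := ⋃ i, (S.piece i).carrier

/-- The `(n-1)`-dimensional area of the hypersurface, computed by the Hausdorff measure of dimension
`n - 1`, normalized to agree with Lebesgue measure on `(n-1)`-dimensional Euclidean spaces. -/
def area : ℝ≥0∞ := μHE[n - 1] S.carrier

/-- The line `l` is transverse to the hypersurface, i.e. to each of its pieces. (Where the point set
is an embedded hypersurface, all pieces through a point have its tangent space there, so that this
is transversality to the embedded hypersurface, whichever pieces are used.) -/
def IsTransverse (l : OrientedLine n) : Prop := ∀ i, (S.piece i).IsTransverse l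

open scoped Classical in
/-- `#(l ∩ S)`: the number (possibly `∞`) of points in which `l` meets the hypersurface if `l` is
transverse to it, and zero otherwise. -/
def count (l : OrientedLine n) : ℝ≥0∞ :=
  if S.IsTransverse l then ((l.points ∩ S.carrier).encard : ℝ≥0∞) else 0

end Hypersurface

/-- `κ_m`, the volume of the unit ball of `ℝᵐ`. -/
def ballVolume (m : ℕ) : ℝ≥0∞ := volume (ball (0 : EuclideanSpace ℝ (Fin m)) 1)

end Crofton

end

open MeasureTheory Set Metric
open scoped ENNReal ContDiff NNReal
open Filter Topology

noncomputable section

set_option linter.unusedSectionVars false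

/-! Fix a direction `v`. The line `(v, p)` meets `Σ` exactly in the points that project orthogonally
to `p ∈ v^⊥`, so integrating the number of these points over `p` gives the area of the projection of
`Σ`, counted with multiplicity. For a graph with axis `a` and height `f` this is `∫ |⟨v, ν⟩| dx`,
where `ν = a - ∇f` is the unnormalized normal (`lintegral_encard_perpProj_graph`). Now integrate
over `v` and exchange the integrals: `∫ |⟨v, ν⟩| dσ(v) = 2 κ_{n-1} ‖ν‖`
(`lintegral_sphere_abs_inner`), and `∫ ‖ν‖ dx` is the area of the graph
(`euclideanHausdorffMeasure_graph`).

Changes of variables between two different hyperplanes are reduced to one in the whole space: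
`sweep` thickens a graph by unit length in direction `v`, its derivative has determinant `⟨v, ν⟩`,
and a region of unit thickness has the volume of its base. For the Hausdorff measure, a graph is cut
into countably many pieces, each of which projects almost isometrically along a nearby normal. The
constant on the sphere comes from evaluating one Gaussian integral in two ways.

Pieces of `Σ` may overlap, so they are first replaced by disjoint measurable pieces, for which
counts and areas add. Lines tangent to some piece form a null set, by the equidimensional Sard
theorem in each direction, so the transversality convention does not affect the integral.
Compactness of `Σ` enters through the measurability of the number of points on a line. -/

namespace Crofton

/-! ### Orthogonal splitting along a unit vector. -/

section Projection

variable {E : Type*} [NormedAddCommGroup E] [InnerProductSpace ℝ E] [FiniteDimensional ℝ E]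

/-- The hyperplane `v^⊥`. -/
abbrev Perp (v : E) : Submodule ℝ E := (Submodule.span ℝ {v})ᗮ

/-- The orthogonal projection onto `v^⊥`. -/
abbrev perpProj (v : E) : E →L[ℝ] Perp v := (Perp v).orthogonalProjectionOnto

theorem coe_perpProj {v : E} (hv : ‖v‖ = 1) (y : E) :
    (perpProj v y : E) = y - inner ℝ v y • v := by
  have h := (Submodule.span ℝ {v}).starProjection_add_starProjection_orthogonal y
  rw [Submodule.starProjection_unit_singleton ℝ hv] at h
  exact eq_sub_of_add_eq' h

@[simp]
theorem perpProj_coe (v : E) (x : Perp v) : perpProj v (x : E) = x :=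
  Submodule.orthogonalProjectionOnto_mem_subspace_eq_self x

@[simp]
theorem perpProj_self (v : E) : perpProj v v = 0 := by
  rw [Submodule.orthogonalProjectionOnto_eq_zero_iff, Submodule.orthogonal_orthogonal]
  exact Submodule.mem_span_singleton_self v

@[simp]
theorem inner_perp (v : E) (x : Perp v) : inner ℝ v (x : E) = 0 :=
  Submodule.mem_orthogonal_singleton_iff_inner_right.1 x.2

theorem inner_perpProj_left (v y : E) (x : Perp v) :
    inner ℝ (perpProj v y) x = inner ℝ y (x : E) := by
  rw [Submodule.coe_inner]
  exact Submodule.inner_orthogonalProjectionOnto_eq_of_mem_right x y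

/-- The splitting of the ambient space into the axis of `v` and the hyperplane `v^⊥`. -/
def axisSplit {v : E} (hv : ‖v‖ = 1) : E ≃ₜ ℝ × Perp v where
  toFun y := (inner ℝ v y, perpProj v y)
  invFun q := (q.2 : E) + q.1 • v
  left_inv y := by simp [coe_perpProj hv]
  right_inv q := by
    ext1
    · simp [inner_add_right, inner_smul_right, hv]
    · simp
  continuous_toFun := by fun_prop
  continuous_invFun := by fun_prop

variable [MeasurableSpace E] [BorelSpace E]

theorem measurePreserving_axisSplit {v : E} (hv : ‖v‖ = 1) :
    MeasurePreserving (axisSplit hv) := by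
  set K : Submodule ℝ E := Submodule.span ℝ {v} with hK
  have hP : MeasurePreserving (fun x : E => WithLp.ofLp (K.orthogonalDecomposition x)) :=
    (WithLp.volume_preserving_ofLp K Kᗮ).comp K.orthogonalDecomposition.measurePreserving
  have e := (LinearIsometryEquiv.toSpanUnitSingleton (𝕜 := ℝ) v hv).symm.measurePreserving
  have h := (e.prod (MeasurePreserving.id (volume : Measure Kᗮ))).comp hP
  have heq : (axisSplit hv : E → ℝ × Perp v) =
      Prod.map (LinearIsometryEquiv.toSpanUnitSingleton (𝕜 := ℝ) v hv).symm id ∘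
        fun x : E => WithLp.ofLp (K.orthogonalDecomposition x) := by
    funext y
    ext1
    · apply (LinearIsometryEquiv.toSpanUnitSingleton (𝕜 := ℝ) v hv).injective
      ext1
      simp [axisSplit, K, Submodule.starProjection_unit_singleton ℝ hv]
    · simp [axisSplit, K]
  rw [heq]
  exact h

/-- The region over `B ⊆ v^⊥` in which the coordinate along `v` lies in `[0, 1]`. -/
def slab (v : E) (B : Set (Perp v)) : Set E := {y | inner ℝ v y ∈ Icc (0 : ℝ) 1 ∧ perpProj v y ∈ B}

theorem slab_eq_preimage {v : E} (hv : ‖v‖ = 1) (B : Set (Perp v)) :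
    slab v B = axisSplit hv ⁻¹' (Icc 0 1 ×ˢ B) := rfl

theorem measurableSet_slab {v : E} (hv : ‖v‖ = 1) {B : Set (Perp v)} (hB : MeasurableSet B) :
    MeasurableSet (slab v B) := by
  rw [slab_eq_preimage hv]
  exact (axisSplit hv).continuous.measurable (measurableSet_Icc.prod hB)

/-- A slab has unit height, so Fubini turns integrals over `v^⊥` into integrals over the whole
space. -/
theorem setLIntegral_slab {v : E} (hv : ‖v‖ = 1) (B : Set (Perp v)) {g : Perp v → ℝ≥0∞}
    (hg : Measurable g) :
    ∫⁻ y in slab v B, g (perpProj v y) = ∫⁻ x in B, g x := by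
  have h := (measurePreserving_axisSplit hv).setLIntegral_comp_preimage_emb
    (axisSplit hv).measurableEmbedding (fun q => g q.2) (Icc 0 1 ×ˢ B)
  rw [slab_eq_preimage hv]
  refine h.trans ?_
  rw [Measure.volume_eq_prod, ← Measure.prod_restrict,
    lintegral_prod_symm' (fun q : ℝ × Perp v => g q.2) (hg.comp measurable_snd)]
  simp

end Projection

/-! ### Projecting a graph to a hyperplane: Jacobian and critical values. -/

section Graph

variable {E : Type*} [NormedAddCommGroup E] [InnerProductSpace ℝ E] [FiniteDimensional ℝ E]
variable {a : E} {f : Perp a → ℝ}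

/-- The graph parametrization `x ↦ x + f(x) a` over `a^⊥`. -/
def graphMap (a : E) (f : Perp a → ℝ) (x : Perp a) : E := (x : E) + f x • a

/-- The normal vector `a - ∇f(x)` of the graph of `f`. -/
def conormal (a : E) (f : Perp a → ℝ) (x : Perp a) : E := a - ((gradient f x : Perp a) : E)

/-- The map `x + c a ↦ x + f(x) a + c v`, which sweeps the graph of `f` in the direction `v`. -/
def sweep (a v : E) (f : Perp a → ℝ) (y : E) : E :=
  graphMap a f (perpProj a y) + inner ℝ a y • v

@[simp]
theorem perpProj_graphMap (a : E) (f : Perp a → ℝ) (x : Perp a) :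
    perpProj a (graphMap a f x) = x := by simp [graphMap]

theorem graphMap_injective (a : E) (f : Perp a → ℝ) : Function.Injective (graphMap a f) :=
  Function.LeftInverse.injective (perpProj_graphMap a f)

theorem inner_conormal (v : E) (x : Perp a) :
    inner ℝ v (conormal a f x) = inner ℝ a v - fderiv ℝ f x (perpProj a v) := by
  rw [conormal, inner_sub_right, real_inner_comm, ← inner_perpProj_left,
    real_inner_comm _ (perpProj a v), inner_gradient_left]

theorem conormal_ne_zero (ha : ‖a‖ = 1) (x : Perp a) : conormal a f x ≠ 0 := by
  intro h
  have := inner_conormal (f := f) a x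
  simp [h, ha] at this

/-- The derivative of `sweep`. -/
def sweepDeriv (a v : E) (f' : Perp a →L[ℝ] ℝ) : E →L[ℝ] E :=
  (Perp a).subtypeL ∘L perpProj a + (f' ∘L perpProj a).smulRight a + (innerSL ℝ a).smulRight v

theorem sweepDeriv_apply (v : E) (f' : Perp a →L[ℝ] ℝ) (h : E) :
    sweepDeriv a v f' h = perpProj a h + f' (perpProj a h) • a + inner ℝ a h • v := by
  simp [sweepDeriv]

/-- The derivative is a product of two transvections, whose determinants are `1` plus the functional
evaluated at the vector. The shear along `a` has determinant `1`, since its functional kills `a`. -/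
theorem det_sweepDeriv (ha : ‖a‖ = 1) (v : E) (x : Perp a) :
    (sweepDeriv a v (fderiv ℝ f x)).det = inner ℝ v (conormal a f x) := by
  set f' := fderiv ℝ f x with hf'
  -- The summand `- f' (perpProj a v) • a` cancels the effect of the outer transvection on `v`.
  have key : (sweepDeriv a v f').toLinearMap =
      LinearMap.transvection (f' ∘L perpProj a).toLinearMap a ∘ₗ
      LinearMap.transvection (innerSL ℝ a).toLinearMap (v - a - f' (perpProj a v) • a) := by
    ext h
    simp only [ContinuousLinearMap.coe_coe, sweepDeriv_apply, LinearMap.comp_apply,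
      LinearMap.transvection.apply, ContinuousLinearMap.comp_apply, innerSL_apply_apply, map_add,
      map_smul, map_sub, perpProj_self, map_zero]
    rw [coe_perpProj ha]
    module
  rw [ContinuousLinearMap.det, key, LinearMap.det_comp, LinearMap.transvection.det,
    LinearMap.transvection.det, inner_conormal]
  simp [inner_sub_right, inner_smul_right, ha, hf']
  ring

theorem hasStrictFDerivAt_graphMap {x : Perp a} {f' : Perp a →L[ℝ] ℝ}
    (hf : HasStrictFDerivAt f f' x) :
    HasStrictFDerivAt (graphMap a f) ((Perp a).subtypeL + f'.smulRight a) x :=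
  (Perp a).subtypeL.hasStrictFDerivAt.add (hf.smul_const a)

theorem hasStrictFDerivAt_sweep (v : E) {y : E} {f' : Perp a →L[ℝ] ℝ}
    (hf : HasStrictFDerivAt f f' (perpProj a y)) :
    HasStrictFDerivAt (sweep a v f) (sweepDeriv a v f') y := by
  have h1 := (hasStrictFDerivAt_graphMap hf).comp y (perpProj a).hasStrictFDerivAt
  have h2 := ((innerSL ℝ a).hasStrictFDerivAt (x := y)).smul_const v
  exact h1.add h2

variable [MeasurableSpace E] [BorelSpace E]

theorem measurable_conormal (a : E) (f : Perp a → ℝ) : Measurable (conormal a f) := by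
  have h1 : Measurable (gradient f) :=
    (InnerProductSpace.toDual ℝ (Perp a)).symm.continuous.measurable.comp (measurable_fderiv ℝ f)
  exact (measurable_const (a := a)).sub (measurable_subtype_coe.comp h1)

theorem perpProj_sweep (v : E) (y : E) :
    perpProj v (sweep a v f y) = perpProj v (graphMap a f (perpProj a y)) := by
  simp [sweep]

/-- Sweeping moves points along `v`, so the projection to `v^⊥` still determines the base point; the
remaining shift along `v` then determines the height in the slab. -/
theorem injOn_sweep (ha : ‖a‖ = 1) {v : E} (hv : ‖v‖ = 1) {B : Set (Perp a)}
    (hB : InjOn (fun x => perpProj v (graphMap a f x)) B) : InjOn (sweep a v f) (slab a B) := by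
  intro y hy y' hy' h
  have h1 : perpProj a y = perpProj a y' := by
    apply hB hy.2 hy'.2
    simp only [← perpProj_sweep, h]
  have h2 : inner ℝ a y = (inner ℝ a y' : ℝ) := by
    simp only [sweep, h1, add_right_inj] at h
    exact smul_left_injective ℝ (by rintro rfl; simp at hv) h
  exact (axisSplit ha).injective (Prod.ext h2 h1)

/-- The image of `sweep`, in the coordinates along and orthogonal to `v`. -/
theorem mem_image_sweep_iff (ha : ‖a‖ = 1) {v : E} (hv : ‖v‖ = 1) (B : Set (Perp a)) (t : ℝ)
    (p : Perp v) :
    (axisSplit hv).symm (t, p) ∈ sweep a v f '' slab a B ↔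
      ∃ x ∈ B, perpProj v (graphMap a f x) = p ∧ t - inner ℝ v (graphMap a f x) ∈ Icc (0 : ℝ) 1 := by
  have hvv : (inner ℝ v v : ℝ) = 1 := by simp [hv]
  constructor
  · rintro ⟨y, hy, h⟩
    rw [Homeomorph.eq_symm_apply] at h
    have h1 := congrArg Prod.fst h
    have h2 := congrArg Prod.snd h
    refine ⟨perpProj a y, hy.2, ?_, ?_⟩
    · rw [← perpProj_sweep]; exact h2
    · have : inner ℝ v (sweep a v f y) = t := h1
      rw [← this, sweep, inner_add_right, inner_smul_right, hvv, add_sub_cancel_left, mul_one]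
      exact hy.1
  · rintro ⟨x, hx, rfl, ht⟩
    set c := t - inner ℝ v (graphMap a f x) with hc
    have hP : perpProj a ((axisSplit ha).symm (c, x)) = x :=
      congrArg Prod.snd ((axisSplit ha).apply_symm_apply (c, x))
    have hI : inner ℝ a ((axisSplit ha).symm (c, x)) = c :=
      congrArg Prod.fst ((axisSplit ha).apply_symm_apply (c, x))
    refine ⟨(axisSplit ha).symm (c, x), ⟨by rw [hI]; exact ht, by rw [hP]; exact hx⟩, ?_⟩
    rw [Homeomorph.eq_symm_apply]
    ext1
    · change inner ℝ v (sweep a v f _) = t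
      rw [sweep, inner_add_right, inner_smul_right, hvv, hP, hI, hc]
      ring
    · change perpProj v (sweep a v f _) = _
      rw [perpProj_sweep, hP]

theorem preimage_image_sweep (ha : ‖a‖ = 1) {v : E} (hv : ‖v‖ = 1) {B : Set (Perp a)}
    (hB : InjOn (fun x => perpProj v (graphMap a f x)) B) {x : Perp a} (hx : x ∈ B) :
    (fun t => (t, perpProj v (graphMap a f x))) ⁻¹'
        ((axisSplit hv).symm ⁻¹' (sweep a v f '' slab a B)) =
      Icc (inner ℝ v (graphMap a f x)) (inner ℝ v (graphMap a f x) + 1) := by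
  ext t
  simp only [mem_preimage, mem_image_sweep_iff ha hv]
  constructor
  · rintro ⟨x', hx', h, h1, h2⟩
    obtain rfl := hB hx' hx h
    exact ⟨by linarith, by linarith⟩
  · rintro ⟨h1, h2⟩
    exact ⟨x, hx, rfl, by linarith, by linarith⟩

/-- The volume swept out by an injectively projected piece of a graph is the volume of its
projection. -/
theorem volume_image_sweep (ha : ‖a‖ = 1) {v : E} (hv : ‖v‖ = 1) {B : Set (Perp a)}
    (hB : InjOn (fun x => perpProj v (graphMap a f x)) B)
    (hm : MeasurableSet (sweep a v f '' slab a B))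
    (hm' : MeasurableSet ((fun x => perpProj v (graphMap a f x)) '' B)) :
    volume (sweep a v f '' slab a B) = volume ((fun x => perpProj v (graphMap a f x)) '' B) := by
  have h1 : MeasurePreserving (axisSplit hv).symm :=
    (measurePreserving_axisSplit hv).symm (axisSplit hv).toMeasurableEquiv
  -- Slice the swept region parallel to `v`: slices over the projection are unit intervals, all
  -- others are empty.
  rw [← h1.measure_preimage hm.nullMeasurableSet, Measure.volume_eq_prod,
    Measure.prod_apply_symm ((axisSplit hv).symm.continuous.measurable hm),
    ← lintegral_indicator_one hm']
  congr 1
  funext p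
  by_cases hp : p ∈ (fun x => perpProj v (graphMap a f x)) '' B
  · rw [indicator_of_mem hp]
    obtain ⟨x, hx, rfl⟩ := hp
    simp only [preimage_image_sweep ha hv hB hx]
    simp
  · rw [indicator_of_notMem hp]
    convert measure_empty (μ := (volume : Measure ℝ))
    rw [eq_empty_iff_forall_notMem]
    intro t ht
    simp only [mem_preimage, mem_image_sweep_iff ha hv] at ht
    obtain ⟨x, hx, h, -⟩ := ht
    exact hp ⟨x, hx, h⟩

theorem hasFDerivAt_sweep_of_mem_slab (v : E) {U B : Set (Perp a)}
    (hf : ∀ x ∈ U, DifferentiableAt ℝ f x) (hBU : B ⊆ U) {y : E} (hy : y ∈ slab a B) :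
    HasFDerivAt (sweep a v f) (sweepDeriv a v (fderiv ℝ f (perpProj a y))) y := by
  have h0 := (hf _ (hBU hy.2)).hasFDerivAt
  have h1 := (((Perp a).subtypeL.hasFDerivAt.add (h0.smul_const a))).comp y
    (perpProj a).hasFDerivAt
  have h2 := ((innerSL ℝ a).hasFDerivAt (x := y)).smul_const v
  exact h1.add h2

/-- The area of the projection to `v^⊥` of an injectively projected piece of a graph. -/
theorem volume_perpProj_graph (ha : ‖a‖ = 1) {v : E} (hv : ‖v‖ = 1) {U B : Set (Perp a)}
    (hf : ∀ x ∈ U, DifferentiableAt ℝ f x) (hBU : B ⊆ U) (hBm : MeasurableSet B)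
    (hB : InjOn (fun x => perpProj v (graphMap a f x)) B) :
    MeasurableSet ((fun x => perpProj v (graphMap a f x)) '' B) ∧
    volume ((fun x => perpProj v (graphMap a f x)) '' B) =
      ∫⁻ x in B, ENNReal.ofReal |inner ℝ v (conormal a f x)| := by
  have hc : ContinuousOn f B := fun x hx => (hf x (hBU hx)).continuousAt.continuousWithinAt
  have hm' : MeasurableSet ((fun x => perpProj v (graphMap a f x)) '' B) := by
    refine hBm.image_of_continuousOn_injOn ?_ hB
    unfold graphMap
    fun_prop
  have hd : ∀ y ∈ slab a B, HasFDerivWithinAt (sweep a v f)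
      (sweepDeriv a v (fderiv ℝ f (perpProj a y))) (slab a B) y := fun y hy =>
    (hasFDerivAt_sweep_of_mem_slab v hf hBU hy).hasFDerivWithinAt
  have hs := measurableSet_slab ha hBm
  have hi := injOn_sweep ha hv hB
  refine ⟨hm', ?_⟩
  rw [← volume_image_sweep ha hv hB (measurable_image_of_fderivWithin hs hd hi) hm',
    ← lintegral_abs_det_fderiv_eq_addHaar_image volume hs hd hi]
  simp only [det_sweepDeriv ha]
  refine setLIntegral_slab ha B (g := fun x => ENNReal.ofReal |inner ℝ v (conormal a f x)|) ?_
  have := measurable_conormal a f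
  fun_prop

/-- The set of critical values of the projection of a graph to `v^⊥` is null. -/
theorem volume_perpProj_graph_eq_zero (ha : ‖a‖ = 1) {v : E} (hv : ‖v‖ = 1) {U Z : Set (Perp a)}
    (hf : ∀ x ∈ U, DifferentiableAt ℝ f x) (hZU : Z ⊆ U)
    (hZ : ∀ x ∈ Z, inner ℝ v (conormal a f x) = (0 : ℝ)) :
    volume ((fun x => perpProj v (graphMap a f x)) '' Z) = 0 := by
  -- The Jacobian of `sweep` vanishes over `Z`, so the swept set is null, and so is almost every
  -- slice of it parallel to `v`.
  have h0 : volume (sweep a v f '' slab a Z) = 0 :=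
    addHaar_image_eq_zero_of_det_fderivWithin_eq_zero volume
      (fun y hy => (hasFDerivAt_sweep_of_mem_slab v hf hZU hy).hasFDerivWithinAt)
      (fun y hy => by rw [det_sweepDeriv ha, hZ _ hy.2])
  have h1 : MeasurePreserving ((axisSplit hv).symm ∘ Prod.swap) (volume.prod volume) volume :=
    MeasurePreserving.comp
      ((measurePreserving_axisSplit hv).symm (axisSplit hv).toMeasurableEquiv)
      Measure.measurePreserving_swap
  have h2 := Measure.measure_ae_null_of_prod_null (h1.quasiMeasurePreserving.preimage_null h0)
  refine measure_mono_null ?_ (ae_iff.1 h2)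
  rintro _ ⟨x, hx, rfl⟩
  -- The slice over a critical value contains a unit interval, so critical values lie in the
  -- exceptional null set.
  have h3 : Icc (inner ℝ v (graphMap a f x)) (inner ℝ v (graphMap a f x) + 1) ⊆
      Prod.mk (perpProj v (graphMap a f x)) ⁻¹'
        ((axisSplit hv).symm ∘ Prod.swap ⁻¹' (sweep a v f '' slab a Z)) := by
    intro t ht
    exact (mem_image_sweep_iff ha hv Z t _).2 ⟨x, hx, rfl, by linarith [ht.1], by linarith [ht.2]⟩
  have h4 := measure_mono (μ := volume) h3
  simp only [Real.volume_Icc, add_sub_cancel_left, ENNReal.ofReal_one] at h4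
  intro h5
  exact absurd (h4.trans_eq h5) (by simp)

end Graph

/-! ### Countable decompositions and counting in a fixed direction. -/

/-- A measurable set on which a hereditary property holds locally splits into countably many
disjoint measurable pieces with this property. -/
theorem exists_measurable_partition {X : Type*} [TopologicalSpace X] [SecondCountableTopology X]
    [MeasurableSpace X] [OpensMeasurableSpace X] {P : Set X → Prop}
    (hP : ∀ s t, s ⊆ t → P t → P s) (h0 : P ∅) {s : Set X} (hs : MeasurableSet s)
    (hloc : ∀ x ∈ s, ∃ N ∈ 𝓝 x, P N) :
    ∃ B : ℕ → Set X, (∀ k, MeasurableSet (B k)) ∧ Pairwise (Function.onFun Disjoint B) ∧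
      (∀ k, P (B k)) ∧ ⋃ k, B k = s := by
  choose! N hN hPN using hloc
  obtain ⟨t, hts, htc, hcov⟩ := TopologicalSpace.countable_cover_nhdsWithin
    (f := fun x => interior (N x)) (s := s)
    fun x hx => mem_nhdsWithin_of_mem_nhds (interior_mem_nhds.2 (hN x hx))
  rcases t.eq_empty_or_nonempty with rfl | hne
  · refine ⟨fun _ => ∅, fun _ => MeasurableSet.empty, fun _ _ _ => disjoint_empty _, fun _ => h0, ?_⟩
    simpa [eq_comm] using hcov
  obtain ⟨e, rfl⟩ := htc.exists_eq_range hne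
  refine ⟨fun k => s ∩ disjointed (fun k => interior (N (e k))) k, fun k =>
    hs.inter (MeasurableSet.disjointed (fun _ => isOpen_interior.measurableSet) k), ?_, ?_, ?_⟩
  · intro i j hij
    exact (disjoint_disjointed _ hij).mono inter_subset_right inter_subset_right
  · intro k
    refine hP _ _ ?_ (hPN (e k) (hts (mem_range_self k)))
    exact inter_subset_right.trans ((disjointed_subset _ k).trans interior_subset)
  · rw [← inter_iUnion, iUnion_disjointed]
    refine inter_eq_left.2 ?_
    simpa using hcov

section Graph

variable {E : Type*} [NormedAddCommGroup E] [InnerProductSpace ℝ E] [FiniteDimensional ℝ E]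
variable {a : E} {f : Perp a → ℝ}

/-- Near a point where it is a submersion, the projection of a graph to `v^⊥` is injective. -/
theorem exists_injOn_perpProj_graph (ha : ‖a‖ = 1) {v : E} (hv : ‖v‖ = 1)
    {x : Perp a} (hf : ContDiffAt ℝ ∞ f x) (hx : inner ℝ v (conormal a f x) ≠ (0 : ℝ)) :
    ∃ N ∈ 𝓝 x, InjOn (fun x => perpProj v (graphMap a f x)) N := by
  have hstr : HasStrictFDerivAt f (fderiv ℝ f x) (perpProj a (x : E)) := by
    rw [perpProj_coe]
    exact hf.hasStrictFDerivAt (by simp)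
  have hsw := hasStrictFDerivAt_sweep v hstr
  have hdet : (sweepDeriv a v (fderiv ℝ f x)).det ≠ 0 := by rwa [det_sweepDeriv ha]
  rw [← ContinuousLinearMap.coe_toContinuousLinearEquivOfDetNeZero _ hdet] at hsw
  set O := (hsw.toOpenPartialHomeomorph (sweep a v f)).source with hO
  have hOx : O ∈ 𝓝 (x : E) :=
    (hsw.toOpenPartialHomeomorph (sweep a v f)).open_source.mem_nhds
      hsw.mem_toOpenPartialHomeomorph_source
  have hinj : InjOn (sweep a v f) O := (hsw.toOpenPartialHomeomorph (sweep a v f)).injOn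
  -- Two graph points with the same projection differ by `c • v`. Hence `sweep` agrees at `x1` and
  -- `x2 + c • a`; near `(x, x)` both lie in `O`, where `sweep` is injective, and projecting to
  -- `a^⊥` gives `x1 = x2`.
  let c : Perp a × Perp a → ℝ := fun q => inner ℝ v (graphMap a f q.1 - graphMap a f q.2)
  have hcont : ContinuousAt (fun q : Perp a × Perp a => (q.2 : E) + c q • a) (x, x) := by
    have h1 : ContinuousAt (fun q : Perp a × Perp a => f q.1) (x, x) :=
      ContinuousAt.comp (f := Prod.fst) (g := f) (x := (x, x)) hf.continuousAt continuousAt_fst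
    have h2 : ContinuousAt (fun q : Perp a × Perp a => f q.2) (x, x) :=
      ContinuousAt.comp (f := Prod.snd) (g := f) (x := (x, x)) hf.continuousAt continuousAt_snd
    simp only [c, graphMap]
    fun_prop
  have hmem : (fun q : Perp a × Perp a => (q.2 : E) + c q • a) ⁻¹' O ∈ 𝓝 (x, x) := by
    apply hcont.preimage_mem_nhds
    simpa [c] using hOx
  rw [nhds_prod_eq, mem_prod_same_iff] at hmem
  obtain ⟨N, hN, hNO⟩ := hmem
  refine ⟨N ∩ (Subtype.val : Perp a → E) ⁻¹' O,
    inter_mem hN (continuous_subtype_val.continuousAt.preimage_mem_nhds hOx), ?_⟩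
  rintro x1 ⟨h1, h1'⟩ x2 ⟨h2, h2'⟩ h
  have h3 : perpProj v (graphMap a f x1 - graphMap a f x2) = 0 := by
    rw [map_sub, sub_eq_zero]; exact h
  obtain ⟨s, hs⟩ : ∃ s : ℝ, s • v = graphMap a f x1 - graphMap a f x2 := by
    rw [Submodule.orthogonalProjectionOnto_eq_zero_iff, Submodule.orthogonal_orthogonal] at h3
    exact Submodule.mem_span_singleton.1 h3
  have hc : c (x1, x2) = s := by simp [c, ← hs, inner_smul_right, hv]
  have h4 : (x1 : E) = (x2 : E) + c (x1, x2) • a := by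
    refine hinj h1' (hNO (mk_mem_prod h1 h2)) ?_
    simp [sweep, ha, inner_add_right, inner_smul_right, hc, hs]
  simpa using congrArg (perpProj a) h4

variable [MeasurableSpace E] [BorelSpace E]

/-- The number of points in which a graph meets the lines of direction `v`, integrated over these
lines. -/
theorem lintegral_encard_perpProj_graph (ha : ‖a‖ = 1) {v : E} (hv : ‖v‖ = 1) {U B : Set (Perp a)}
    (hf : ∀ x ∈ U, ContDiffAt ℝ ∞ f x) (hBU : B ⊆ U) (hBm : MeasurableSet B) :
    AEMeasurable
        (fun p => ((B ∩ (fun x => perpProj v (graphMap a f x)) ⁻¹' {p}).encard : ℝ≥0∞)) ∧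
    ∫⁻ p, ((B ∩ (fun x => perpProj v (graphMap a f x)) ⁻¹' {p}).encard : ℝ≥0∞) =
      ∫⁻ x in B, ENNReal.ofReal |inner ℝ v (conormal a f x)| := by
  set g : Perp a → Perp v := fun x => perpProj v (graphMap a f x) with hg
  have hd : ∀ x ∈ U, DifferentiableAt ℝ f x := fun x hx => (hf x hx).differentiableAt (by simp)
  have hν := measurable_conormal a f
  set M : Set (Perp a) := {x | inner ℝ v (conormal a f x) ≠ (0 : ℝ)} with hM
  have hMm : MeasurableSet M := by
    have : Measurable fun x => (inner ℝ v (conormal a f x) : ℝ) := by fun_prop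
    exact (this (measurableSet_singleton 0)).compl
  obtain ⟨C, hCm, hCd, hCi, hCu⟩ := exists_measurable_partition (P := InjOn g)
    (fun s t hst ht => ht.mono hst) (injOn_empty g) (hBm.inter hMm)
    fun x hx => exists_injOn_perpProj_graph ha hv (hf x (hBU hx.1)) hx.2
  have hCB : ∀ k, C k ⊆ B := fun k => (subset_iUnion C k).trans (hCu ▸ inter_subset_left)
  have himg := fun k => volume_perpProj_graph ha hv hd ((hCB k).trans hBU) (hCm k) (hCi k)
  have hnull : volume (g '' (B \ M)) = 0 :=
    volume_perpProj_graph_eq_zero ha hv hd (sdiff_subset.trans hBU) fun x hx => not_not.1 hx.2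
  -- Off the null set of critical values, the whole fibre lies in the pieces `C k`, and each piece
  -- contributes at most one point.
  have hcount : (fun p : Perp v => ((B ∩ g ⁻¹' {p}).encard : ℝ≥0∞)) =ᵐ[volume]
      fun p => ∑' k, (g '' C k).indicator 1 p := by
    filter_upwards [compl_mem_ae_iff.2 hnull] with p hp
    have h1 : B ∩ g ⁻¹' {p} = ⋃ k, C k ∩ g ⁻¹' {p} := by
      rw [← iUnion_inter, hCu]
      ext x
      refine ⟨fun hx => ⟨⟨hx.1, ?_⟩, hx.2⟩, fun hx => ⟨hx.1.1, hx.2⟩⟩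
      by_contra hxM
      exact hp ⟨x, ⟨hx.1, hxM⟩, hx.2⟩
    have hsub : ∀ k, (C k ∩ g ⁻¹' {p}).Subsingleton := fun k x hx y hy =>
      hCi k hx.1 hy.1 ((show g x = p from hx.2).trans (show g y = p from hy.2).symm)
    have hms : ∀ k, MeasurableSet (C k ∩ g ⁻¹' {p}) := fun k => (hsub k).measurableSet
    rw [h1, ← Measure.count_apply (MeasurableSet.iUnion hms), measure_iUnion
      (fun i j hij => (hCd hij).mono inter_subset_left inter_subset_left) hms]
    refine tsum_congr fun k => ?_
    rw [Measure.count_apply (hms k)]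
    by_cases hpk : p ∈ g '' C k
    · obtain ⟨x, hx, rfl⟩ := hpk
      have : C k ∩ g ⁻¹' {g x} = {x} := (hsub k).eq_singleton_of_mem ⟨hx, rfl⟩
      rw [this, indicator_of_mem (mem_image_of_mem g hx)]
      simp
    · have : C k ∩ g ⁻¹' {p} = ∅ := by
        rw [eq_empty_iff_forall_notMem]
        exact fun x hx => hpk ⟨x, hx.1, hx.2⟩
      rw [this, indicator_of_notMem hpk]
      simp
  refine ⟨(Measurable.tsum fun k =>
    measurable_one.indicator (himg k).1).aemeasurable.congr hcount.symm, ?_⟩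
  rw [lintegral_congr_ae hcount, lintegral_tsum fun k =>
    (measurable_one.indicator (himg k).1).aemeasurable]
  have h2 : ∫⁻ x in B \ M, ENNReal.ofReal |inner ℝ v (conormal a f x)| = 0 := by
    rw [setLIntegral_congr_fun (g := fun _ => 0) (hBm.diff hMm)]
    · simp
    · intro x hx
      have : inner ℝ v (conormal a f x) = (0 : ℝ) := not_not.1 hx.2
      simp [this]
  rw [← lintegral_inter_add_sdiff _ B hMm, h2, add_zero, ← hCu, lintegral_iUnion hCm hCd]
  refine tsum_congr fun k => ?_
  rw [lintegral_indicator_one (himg k).1]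
  exact (himg k).2

end Graph

/-! ### Hausdorff measure of a graph. -/

theorem euclideanHausdorffMeasure_image_le {X Y : Type*} [EMetricSpace X] [MeasurableSpace X]
    [BorelSpace X] [EMetricSpace Y] [MeasurableSpace Y] [BorelSpace Y] {K : ℝ≥0} {f : X → Y}
    {s : Set X} (h : LipschitzOnWith K f s) (d : ℕ) :
    μHE[d] (f '' s) ≤ (K : ℝ≥0∞) ^ d * μHE[d] s := by
  simp only [Measure.euclideanHausdorffMeasure_def, Measure.smul_apply, ENNReal.smul_def, smul_eq_mul]
  calc _ ≤ _ * ((K : ℝ≥0∞) ^ (d : ℝ) * μH[d] s) :=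
        mul_le_mul_right (h.hausdorffMeasure_image_le (by positivity)) _
    _ = _ := by rw [ENNReal.rpow_natCast]; ring

theorem finrank_perp {E : Type*} [NormedAddCommGroup E] [InnerProductSpace ℝ E]
    [FiniteDimensional ℝ E] {v : E} (hv : ‖v‖ = 1) :
    Module.finrank ℝ (Perp v) = Module.finrank ℝ E - 1 := by
  have h1 := (Submodule.span ℝ {v}).finrank_add_finrank_orthogonal
  rw [finrank_span_singleton (by rintro rfl; simp at hv)] at h1
  unfold Perp
  omega

section Graph

variable {E : Type*} [NormedAddCommGroup E] [InnerProductSpace ℝ E] [FiniteDimensional ℝ E]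
variable {a : E} {f : Perp a → ℝ}

/-- The projection of the graph over `N` to `v^⊥` is almost isometric, up to a factor `1 - δ`. -/
def IsAlmostFlat (f : Perp a → ℝ) (δ : ℝ) (N : Set (Perp a)) : Prop :=
  ∃ v : E, ‖v‖ = 1 ∧ (∀ x ∈ N, (1 - δ) * ‖conormal a f x‖ ≤ |inner ℝ v (conormal a f x)|) ∧
    ∀ x ∈ N, ∀ y ∈ N, (1 - δ) * ‖graphMap a f x - graphMap a f y‖ ≤
      ‖perpProj v (graphMap a f x) - perpProj v (graphMap a f y)‖

theorem norm_perpProj_le (v y : E) : ‖perpProj v y‖ ≤ ‖y‖ :=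
  (Perp v).norm_orthogonalProjectionOnto_apply_le y

theorem norm_le_norm_perpProj_add {v : E} (hv : ‖v‖ = 1) (y : E) :
    ‖y‖ ≤ ‖perpProj v y‖ + |inner ℝ v y| := by
  have h : y = perpProj v y + (inner ℝ v y : ℝ) • v := by rw [coe_perpProj hv]; simp
  calc ‖y‖ = ‖(perpProj v y : E) + (inner ℝ v y : ℝ) • v‖ := by rw [← h]
    _ ≤ _ := (norm_add_le _ _).trans (by simp [norm_smul, hv])

theorem norm_sub_le_norm_graphMap_sub (x y : Perp a) :
    ‖x - y‖ ≤ ‖graphMap a f x - graphMap a f y‖ := by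
  simpa using norm_perpProj_le a (graphMap a f x - graphMap a f y)

theorem continuousAt_conormal {x : Perp a} (hf : ContDiffAt ℝ ∞ f x) :
    ContinuousAt (conormal a f) x := by
  have h1 : ContinuousAt (fderiv ℝ f) x :=
    (hf.fderiv_right (m := 0) (by simp)).continuousAt
  have h2 : ContinuousAt (gradient f) x :=
    (InnerProductSpace.toDual ℝ (Perp a)).symm.continuous.continuousAt.comp h1
  exact continuousAt_const.sub (continuous_subtype_val.continuousAt.comp h2)

theorem inner_conormal_tangent (ha : ‖a‖ = 1) (x h : Perp a) :
    inner ℝ (conormal a f x) ((h : E) + fderiv ℝ f x h • a) = (0 : ℝ) := by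
  rw [real_inner_comm, inner_conormal]
  simp [inner_add_right, inner_smul_right, ha]

/-- Take `v` to be the unit normal at `x`. By continuity, nearby normals keep almost their full
length along `v`. By strict differentiability, short chords near `x` are almost tangent at `x`,
hence almost orthogonal to `v`. -/
theorem exists_isAlmostFlat (ha : ‖a‖ = 1) {x : Perp a} (hf : ContDiffAt ℝ ∞ f x) {δ : ℝ}
    (hδ : 0 < δ) : ∃ N ∈ 𝓝 x, IsAlmostFlat f δ N := by
  set w := conormal a f x with hw
  have hw0 : 0 < ‖w‖ := norm_pos_iff.2 (conormal_ne_zero ha x)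
  set v := ‖w‖⁻¹ • w with hvdef
  have hv : ‖v‖ = 1 := by simp [hvdef, norm_smul, hw0.ne']
  have hc := continuousAt_conormal hf
  have h1 : ∀ᶠ y in 𝓝 x, (1 - δ) * ‖conormal a f y‖ < inner ℝ v (conormal a f y) := by
    refine ContinuousAt.eventually_lt (by fun_prop) (by fun_prop) ?_
    rw [← hw, hvdef, real_inner_smul_left, real_inner_self_eq_norm_sq]
    have : ‖w‖⁻¹ * ‖w‖ ^ 2 = ‖w‖ := by field_simp
    rw [this]
    nlinarith
  obtain ⟨N, hN, hlin⟩ := (hasStrictFDerivAt_graphMap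
    (hf.hasStrictFDerivAt (by simp))).approximates_deriv_on_nhds (c := ⟨δ, hδ.le⟩) (Or.inr hδ)
  refine ⟨N ∩ _, inter_mem hN h1, v, hv, fun y hy => hy.2.le.trans (le_abs_self _), ?_⟩
  rintro y ⟨hy, -⟩ z ⟨hz, -⟩
  have h2 := hlin y hy z hz
  have h3 : |inner ℝ v (graphMap a f y - graphMap a f z)| ≤ δ * ‖y - z‖ := by
    have h4 : inner ℝ v (((y - z : Perp a) : E) + fderiv ℝ f x (y - z) • a) = (0 : ℝ) := by
      rw [hvdef, real_inner_smul_left, inner_conormal_tangent ha, mul_zero]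
    refine le_trans ?_ h2
    have h5 := abs_real_inner_le_norm v (graphMap a f y - graphMap a f z -
      ((Perp a).subtypeL + (fderiv ℝ f x).smulRight a) (y - z))
    rw [hv, one_mul] at h5
    refine le_trans (le_of_eq ?_) h5
    congr 1
    rw [eq_comm, inner_sub_right v (graphMap a f y - graphMap a f z), sub_eq_self]
    exact h4
  -- Projection costs a chord at most its component along `v`, which is at most `δ * ‖y - z‖`, and
  -- `‖y - z‖` is at most the length of the chord.
  have h6 := norm_le_norm_perpProj_add hv (graphMap a f y - graphMap a f z)
  have h7 : δ * ‖y - z‖ ≤ δ * ‖graphMap a f y - graphMap a f z‖ :=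
    mul_le_mul_of_nonneg_left (norm_sub_le_norm_graphMap_sub y z) hδ.le
  rw [← map_sub]
  linarith

variable [MeasurableSpace E] [BorelSpace E]

/-- Both quantities are compared with the projected area `∫ |⟨v, ν⟩|`, which lies between `(1 - δ) ∫
‖ν‖` and `∫ ‖ν‖`. The projection is `1`-Lipschitz and its inverse on the piece is `(1 -
δ)⁻¹`-Lipschitz. -/
theorem euclideanHausdorffMeasure_graph_of_isAlmostFlat (ha : ‖a‖ = 1) {U B : Set (Perp a)}
    (hf : ∀ x ∈ U, ContDiffAt ℝ ∞ f x) (hBU : B ⊆ U) (hBm : MeasurableSet B) {δ : ℝ≥0}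
    (hδ : δ < 1) (hB : IsAlmostFlat f δ B) :
    (1 - δ : ℝ≥0) * ∫⁻ x in B, ENNReal.ofReal ‖conormal a f x‖ ≤
        μHE[Module.finrank ℝ E - 1] (graphMap a f '' B) ∧
      ((1 - δ : ℝ≥0) : ℝ≥0∞) ^ (Module.finrank ℝ E - 1) *
        μHE[Module.finrank ℝ E - 1] (graphMap a f '' B) ≤
        ∫⁻ x in B, ENNReal.ofReal ‖conormal a f x‖ := by
  obtain ⟨v, hv, h1, h2⟩ := hB
  set g : Perp a → Perp v := fun x => perpProj v (graphMap a f x) with hg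
  set r : ℝ≥0 := 1 - δ with hr
  have hrc : (1 - δ : ℝ) = r := by rw [hr, NNReal.coe_sub hδ.le]; simp
  have hr0 : r ≠ 0 := (tsub_pos_of_lt hδ).ne'
  have hr0' : 0 < (r : ℝ) := NNReal.coe_pos.2 (tsub_pos_of_lt hδ)
  rw [hrc] at h1 h2
  have hinj : InjOn g B := by
    intro x hx y hy hxy
    have h3 := h2 x hx y hy
    have h4 : perpProj v (graphMap a f x) = perpProj v (graphMap a f y) := hxy
    rw [h4, sub_self, norm_zero] at h3
    have h5 : ‖graphMap a f x - graphMap a f y‖ ≤ 0 := by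
      by_contra h
      nlinarith [mul_pos hr0' (not_le.1 h)]
    exact graphMap_injective a f (sub_eq_zero.1 (norm_le_zero_iff.1 h5))
  obtain ⟨-, hvol⟩ := volume_perpProj_graph ha hv
    (fun x hx => (hf x hx).differentiableAt (by simp)) hBU hBm hinj
  rw [← InnerProductSpace.euclideanHausdorffMeasure_eq_volume, finrank_perp hv] at hvol
  set m := Module.finrank ℝ E - 1
  have hν := measurable_conormal a f
  constructor
  · calc (r : ℝ≥0∞) * ∫⁻ x in B, ENNReal.ofReal ‖conormal a f x‖
        = ∫⁻ x in B, ENNReal.ofReal (r * ‖conormal a f x‖) := by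
          rw [← lintegral_const_mul _ (by fun_prop)]
          simp only [ENNReal.ofReal_mul hr0'.le, ENNReal.ofReal_coe_nnreal]
      _ ≤ ∫⁻ x in B, ENNReal.ofReal |inner ℝ v (conormal a f x)| :=
          setLIntegral_mono' hBm fun x hx => ENNReal.ofReal_le_ofReal (h1 x hx)
      _ = μHE[m] (perpProj v '' (graphMap a f '' B)) := by rw [← hvol, image_image]
      _ ≤ _ := by
          have hl : LipschitzOnWith 1 (perpProj v) (graphMap a f '' B) :=
            ((Perp v).lipschitzWith_orthogonalProjectionOnto).lipschitzOnWith
          simpa using euclideanHausdorffMeasure_image_le hl m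
  · rcases B.eq_empty_or_nonempty with rfl | hne
    · simp
    have : Nonempty (Perp a) := ⟨0⟩
    have hl : LipschitzOnWith r⁻¹ (fun p => graphMap a f (Function.invFunOn g B p)) (g '' B) := by
      apply LipschitzOnWith.of_dist_le_mul
      rintro _ ⟨x, hx, rfl⟩ _ ⟨y, hy, rfl⟩
      rw [hinj.leftInvOn_invFunOn hx, hinj.leftInvOn_invFunOn hy, dist_eq_norm, dist_eq_norm,
        NNReal.coe_inv, le_inv_mul_iff₀ hr0']
      exact h2 x hx y hy
    have h3 := euclideanHausdorffMeasure_image_le hl m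
    have h4 : (fun p => graphMap a f (Function.invFunOn g B p)) '' (g '' B) = graphMap a f '' B := by
      rw [image_image]
      exact image_congr fun x hx => by rw [hinj.leftInvOn_invFunOn hx]
    rw [h4, hvol] at h3
    calc (r : ℝ≥0∞) ^ m * μHE[m] (graphMap a f '' B)
        ≤ (r : ℝ≥0∞) ^ m * (((r⁻¹ : ℝ≥0) : ℝ≥0∞) ^ m *
          ∫⁻ x in B, ENNReal.ofReal |inner ℝ v (conormal a f x)|) := mul_le_mul_right h3 _
      _ = ∫⁻ x in B, ENNReal.ofReal |inner ℝ v (conormal a f x)| := by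
          rw [← mul_assoc, ← mul_pow, ← ENNReal.coe_mul, mul_inv_cancel₀ hr0]
          simp
      _ ≤ _ := by
          refine lintegral_mono fun x => ENNReal.ofReal_le_ofReal ?_
          simpa [hv] using abs_real_inner_le_norm v (conormal a f x)

/-- The area of a graph. -/
theorem euclideanHausdorffMeasure_graph (ha : ‖a‖ = 1) {U B : Set (Perp a)}
    (hf : ∀ x ∈ U, ContDiffAt ℝ ∞ f x) (hBU : B ⊆ U) (hBm : MeasurableSet B) :
    μHE[Module.finrank ℝ E - 1] (graphMap a f '' B) =
      ∫⁻ x in B, ENNReal.ofReal ‖conormal a f x‖ := by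
  set m := Module.finrank ℝ E - 1 with hm
  have key : ∀ δ : ℝ≥0, 0 < δ → δ < 1 →
      (1 - δ : ℝ≥0) * ∫⁻ x in B, ENNReal.ofReal ‖conormal a f x‖ ≤ μHE[m] (graphMap a f '' B) ∧
      ((1 - δ : ℝ≥0) : ℝ≥0∞) ^ m * μHE[m] (graphMap a f '' B) ≤
        ∫⁻ x in B, ENNReal.ofReal ‖conormal a f x‖ := by
    intro δ hδ0 hδ
    obtain ⟨C, hCm, hCd, hCP, hCu⟩ := exists_measurable_partition (P := IsAlmostFlat f δ)
      (fun s t hst ⟨v, hv, h1, h2⟩ =>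
        ⟨v, hv, fun x hx => h1 x (hst hx), fun x hx y hy => h2 x (hst hx) y (hst hy)⟩)
      ⟨a, ha, by simp, by simp⟩ hBm fun x hx => exists_isAlmostFlat ha (hf x (hBU hx)) hδ0
    have hCB : ∀ k, C k ⊆ B := fun k => (subset_iUnion C k).trans hCu.subset
    have hC := fun k => euclideanHausdorffMeasure_graph_of_isAlmostFlat ha hf
      ((hCB k).trans hBU) (hCm k) hδ (hCP k)
    have himg : μHE[m] (graphMap a f '' B) = ∑' k, μHE[m] (graphMap a f '' C k) := by
      rw [← hCu, image_iUnion, measure_iUnion]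
      · exact fun i j hij => (disjoint_image_iff (graphMap_injective a f)).2 (hCd hij)
      · intro k
        refine (hCm k).image_of_continuousOn_injOn ?_ (graphMap_injective a f).injOn
        have : ContinuousOn f (C k) := fun x hx =>
          (hf x (hBU (hCB k hx))).continuousAt.continuousWithinAt
        unfold graphMap
        fun_prop
    have hint : ∫⁻ x in B, ENNReal.ofReal ‖conormal a f x‖ =
        ∑' k, ∫⁻ x in C k, ENNReal.ofReal ‖conormal a f x‖ := by
      rw [← hCu, lintegral_iUnion hCm hCd]
    rw [himg, hint, ← ENNReal.tsum_mul_left, ← ENNReal.tsum_mul_left]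
    exact ⟨ENNReal.tsum_le_tsum fun k => (hC k).1, ENNReal.tsum_le_tsum fun k => (hC k).2⟩
  -- Let `δ → 0`. The exponent is `m` for one inequality and `1` for the other.
  have hlim : ∀ (k : ℕ) (c d : ℝ≥0∞),
      (∀ δ : ℝ≥0, 0 < δ → δ < 1 → ((1 - δ : ℝ≥0) : ℝ≥0∞) ^ k * c ≤ d) → c ≤ d := by
    intro k c d h
    have h1 : Tendsto (fun δ : ℝ≥0 => ((1 - δ : ℝ≥0) : ℝ≥0∞) ^ k) (𝓝[>] 0) (𝓝 1) := by
      have : Continuous fun δ : ℝ≥0 => (((1 - δ) ^ k : ℝ≥0) : ℝ≥0∞) := by fun_prop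
      have h2 := (this.tendsto 0).mono_left (nhdsWithin_le_nhds (s := Ioi 0))
      simpa using h2
    have h2 : Tendsto (fun δ : ℝ≥0 => ((1 - δ : ℝ≥0) : ℝ≥0∞) ^ k * c) (𝓝[>] 0) (𝓝 (1 * c)) :=
      ENNReal.Tendsto.mul_const h1 (Or.inl one_ne_zero)
    rw [one_mul] at h2
    refine le_of_tendsto h2 ?_
    filter_upwards [Ioo_mem_nhdsGT (zero_lt_one : (0 : ℝ≥0) < 1)] with δ hδ
    exact h δ hδ.1 hδ.2
  refine le_antisymm (hlim m _ _ fun δ h0 h1 => (key δ h0 h1).2) (hlim 1 _ _ fun δ h0 h1 => ?_)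
  rw [pow_one]
  exact (key δ h0 h1).1

end Graph

/-! ### Gaussian integrals and the constant on the sphere. -/

section Sphere

variable {E : Type*} [NormedAddCommGroup E] [InnerProductSpace ℝ E] [FiniteDimensional ℝ E]
  [MeasurableSpace E] [BorelSpace E]

/-- Integration in polar coordinates. -/
theorem lintegral_polar [Nontrivial E] (g : E → ℝ≥0∞) :
    ∫⁻ y, g y = ∫⁻ q : sphere (0 : E) 1 × Ioi (0 : ℝ), g ((q.2 : ℝ) • (q.1 : E))
      ∂((volume : Measure E).toSphere.prod (Measure.volumeIoiPow (Module.finrank ℝ E - 1))) := by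
  have h := (volume : Measure E).measurePreserving_homeomorphUnitSphereProd.lintegral_comp_emb
    (Homeomorph.measurableEmbedding _)
    (fun q : sphere (0 : E) 1 × Ioi (0 : ℝ) => g ((q.2 : ℝ) • (q.1 : E)))
  rw [← h]
  simp only [← homeomorphUnitSphereProd_symm_apply_coe, Homeomorph.symm_apply_apply]
  rw [lintegral_subtype_comap (measurableSet_singleton (0 : E)).compl g, restrict_compl_singleton]

theorem lintegral_volumeIoiPow (m : ℕ) {g : ℝ → ℝ≥0∞} (hg : Measurable g) :
    ∫⁻ r : Ioi (0 : ℝ), g r ∂(Measure.volumeIoiPow m) =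
      ∫⁻ r in Ioi (0 : ℝ), ENNReal.ofReal (r ^ m) * g r := by
  rw [Measure.volumeIoiPow, lintegral_withDensity_eq_lintegral_mul _ (by fun_prop) (by fun_prop)]
  exact lintegral_subtype_comap measurableSet_Ioi fun r => ENNReal.ofReal (r ^ m) * g r

theorem integral_pow_mul_exp_neg_sq (m : ℕ) :
    ∫ r in Ioi (0 : ℝ), r ^ m * Real.exp (-r ^ 2) = Real.Gamma ((m + 1) / 2) / 2 := by
  have h := integral_rpow_mul_exp_neg_rpow (p := 2) (q := m) (by norm_num)
    (lt_of_lt_of_le (by norm_num) m.cast_nonneg)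
  simp only [Real.rpow_natCast, Real.rpow_two] at h
  rw [h]
  ring

theorem lintegral_pow_mul_exp_neg_sq (m : ℕ) :
    ∫⁻ r in Ioi (0 : ℝ), ENNReal.ofReal (r ^ m * Real.exp (-r ^ 2)) =
      ENNReal.ofReal (Real.Gamma ((m + 1) / 2) / 2) := by
  rw [← integral_pow_mul_exp_neg_sq, ofReal_integral_eq_lintegral_ofReal]
  -- The Bochner integral of a non-integrable function is `0`, so the nonzero value already found
  -- gives integrability.
  · apply Integrable.of_integral_ne_zero
    rw [integral_pow_mul_exp_neg_sq]
    have := Real.Gamma_pos_of_pos (s := (m + 1) / 2) (by positivity)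
    positivity
  · filter_upwards [ae_restrict_mem measurableSet_Ioi] with r hr
    have : 0 < r := hr
    positivity

theorem lintegral_abs_mul_exp_neg_sq :
    ∫⁻ t : ℝ, ENNReal.ofReal (|t| * Real.exp (-t ^ 2)) = 1 := by
  have h : ∫ t : ℝ, |t| * Real.exp (-t ^ 2) = 1 := by
    have h1 := integral_comp_abs (f := fun t => t * Real.exp (-t ^ 2))
    have h2 := integral_pow_mul_exp_neg_sq 1
    simp only [sq_abs] at h1
    simp only [pow_one] at h2
    rw [h1, h2]
    norm_num
  rw [← ofReal_integral_eq_lintegral_ofReal, h, ENNReal.ofReal_one]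
  · apply Integrable.of_integral_ne_zero
    simp [h]
  · exact Filter.Eventually.of_forall fun t => by positivity

theorem lintegral_exp_neg_norm_sq (V : Type*) [NormedAddCommGroup V] [InnerProductSpace ℝ V]
    [FiniteDimensional ℝ V] [MeasurableSpace V] [BorelSpace V] :
    ∫⁻ p : V, ENNReal.ofReal (Real.exp (-‖p‖ ^ 2)) =
      ENNReal.ofReal (√Real.pi ^ Module.finrank ℝ V) := by
  have h := GaussianFourier.integral_rexp_neg_mul_sq_norm (V := V) (b := 1) one_pos
  have h2 : (Real.pi / 1) ^ ((Module.finrank ℝ V : ℝ) / 2) = √Real.pi ^ Module.finrank ℝ V := by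
    rw [div_one, Real.sqrt_eq_rpow, ← Real.rpow_natCast, ← Real.rpow_mul Real.pi_nonneg]
    ring_nf
  simp only [neg_mul, one_mul] at h
  rw [h2] at h
  rw [← ofReal_integral_eq_lintegral_ofReal, h]
  · apply Integrable.of_integral_ne_zero
    rw [h]
    positivity
  · exact Filter.Eventually.of_forall fun t => by positivity

theorem ballVolume_eq (m : ℕ) :
    ballVolume m = ENNReal.ofReal (√Real.pi ^ m / Real.Gamma (m / 2 + 1)) := by
  rcases m.eq_zero_or_pos with rfl | hm
  · have h : (ball (0 : EuclideanSpace ℝ (Fin 0)) 1) = {0} := by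
      ext x
      simp [Subsingleton.elim x 0]
    have h2 := (EuclideanSpace.basisFun (Fin 0) ℝ).volume_parallelepiped
    have h3 : parallelepiped (EuclideanSpace.basisFun (Fin 0) ℝ) = {0} := by simp [parallelepiped]
    rw [h3] at h2
    rw [ballVolume, h, h2]
    simp
  · have : Nonempty (Fin m) := ⟨⟨0, hm⟩⟩
    simp [ballVolume, EuclideanSpace.volume_ball]

/-- Evaluate `∫ |⟨e, y⟩| exp (-‖y‖²) dy` twice: splitting off the axis `e` gives `√π ^ (n - 1)`,
while polar coordinates give the wanted integral times `Γ((n + 1) / 2) / 2`. -/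
theorem lintegral_sphere_abs_inner_unit {e : E} (he : ‖e‖ = 1) :
    ∫⁻ v : sphere (0 : E) 1, ENNReal.ofReal |inner ℝ (v : E) e| ∂(volume : Measure E).toSphere =
      2 * ballVolume (Module.finrank ℝ E - 1) := by
  have hnt : Nontrivial E := ⟨e, 0, by rintro rfl; simp at he⟩
  set n := Module.finrank ℝ E with hn
  have hn0 : 0 < n := Module.finrank_pos
  set c := ∫⁻ v : sphere (0 : E) 1, ENNReal.ofReal |inner ℝ (v : E) e|
    ∂(volume : Measure E).toSphere with hc
  have hΓ : 0 < Real.Gamma ((n + 1 : ℝ) / 2) := Real.Gamma_pos_of_pos (by positivity)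
  have h1 : ∫⁻ y : E, ENNReal.ofReal (|inner ℝ e y| * Real.exp (-‖y‖ ^ 2)) =
      ENNReal.ofReal (√Real.pi ^ (n - 1)) := by
    have h := (measurePreserving_axisSplit he).lintegral_comp_emb
      (axisSplit he).measurableEmbedding (fun q => ENNReal.ofReal (|q.1| * Real.exp (-q.1 ^ 2)) *
        ENNReal.ofReal (Real.exp (-‖q.2‖ ^ 2)))
    rw [Measure.volume_eq_prod, lintegral_prod_mul (f := fun t : ℝ =>
        ENNReal.ofReal (|t| * Real.exp (-t ^ 2)))
        (g := fun p : Perp e => ENNReal.ofReal (Real.exp (-‖p‖ ^ 2))) (by fun_prop) (by fun_prop),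
      lintegral_abs_mul_exp_neg_sq, lintegral_exp_neg_norm_sq, one_mul, finrank_perp he] at h
    rw [← h]
    refine lintegral_congr fun y => ?_
    rw [← ENNReal.ofReal_mul (by positivity), mul_assoc, ← Real.exp_add]
    change _ = ENNReal.ofReal (|inner ℝ e y| * Real.exp (-(inner ℝ e y) ^ 2 + -‖perpProj e y‖ ^ 2))
    have h3 : ‖y‖ ^ 2 = (inner ℝ e y) ^ 2 + ‖perpProj e y‖ ^ 2 := by
      rw [Submodule.norm_sq_eq_add_norm_sq_projection y (Submodule.span ℝ {e}),
        Submodule.coe_norm ((Submodule.span ℝ {e}).orthogonalProjectionOnto y)]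
      simp [Submodule.starProjection_unit_singleton ℝ he, norm_smul, he]
    rw [h3, neg_add]
  have h2 : ∫⁻ y : E, ENNReal.ofReal (|inner ℝ e y| * Real.exp (-‖y‖ ^ 2)) =
      c * ENNReal.ofReal (Real.Gamma ((n + 1) / 2) / 2) := by
    rw [lintegral_polar, ← lintegral_pow_mul_exp_neg_sq n]
    have h3 : ∀ q : sphere (0 : E) 1 × Ioi (0 : ℝ),
        ENNReal.ofReal (|inner ℝ e ((q.2 : ℝ) • (q.1 : E))| *
          Real.exp (-‖(q.2 : ℝ) • (q.1 : E)‖ ^ 2)) =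
        ENNReal.ofReal |inner ℝ (q.1 : E) e| *
          ENNReal.ofReal ((q.2 : ℝ) * Real.exp (-(q.2 : ℝ) ^ 2)) := by
      rintro ⟨v, r, hr⟩
      have hr' : 0 < r := hr
      rw [← ENNReal.ofReal_mul (by positivity)]
      simp only [inner_smul_right, norm_smul, norm_eq_of_mem_sphere, abs_mul, abs_of_pos hr',
        Real.norm_eq_abs, real_inner_comm e]
      ring_nf
    rw [lintegral_congr h3, lintegral_prod_mul (f := fun v : sphere (0 : E) 1 =>
      ENNReal.ofReal |inner ℝ (v : E) e|) (g := fun r : Ioi (0 : ℝ) =>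
      ENNReal.ofReal ((r : ℝ) * Real.exp (-(r : ℝ) ^ 2))) (by fun_prop) (by fun_prop),
      lintegral_volumeIoiPow (n - 1) (g := fun r => ENNReal.ofReal (r * Real.exp (-r ^ 2)))
        (by fun_prop)]
    congr 1
    refine setLIntegral_congr_fun measurableSet_Ioi fun r hr => ?_
    have hr' : 0 < r := hr
    -- The radial density `r ^ (n - 1)` picks up one more `r` from the homogeneity of `|⟨e, y⟩|`.
    rw [← ENNReal.ofReal_mul (by positivity), ← mul_assoc, ← pow_succ, Nat.sub_add_cancel hn0]
  have h4 : (((n - 1 : ℕ) : ℝ) / 2 + 1) = (n + 1) / 2 := by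
    rw [Nat.cast_sub hn0]; push_cast; ring
  have h5 := h2.symm.trans h1
  -- The Gamma factor cancels because `κ_{n-1}` has denominator `Γ((n - 1) / 2 + 1) = Γ((n + 1) /
  -- 2)`.
  have h6 : ENNReal.ofReal (√Real.pi ^ (n - 1)) =
      (2 * ballVolume (n - 1)) * ENNReal.ofReal (Real.Gamma ((n + 1) / 2) / 2) := by
    rw [ballVolume_eq, h4, ← ENNReal.ofReal_ofNat 2, ← ENNReal.ofReal_mul (by norm_num),
      ← ENNReal.ofReal_mul (by positivity)]
    congr 1
    field_simp
  rw [h6] at h5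
  exact (ENNReal.mul_left_inj (by simpa using hΓ) ENNReal.ofReal_ne_top).1 h5

/-- The integral of `|⟨v, w⟩|` over the unit sphere. -/
theorem lintegral_sphere_abs_inner (w : E) :
    ∫⁻ v : sphere (0 : E) 1, ENNReal.ofReal |inner ℝ (v : E) w| ∂(volume : Measure E).toSphere =
      2 * ballVolume (Module.finrank ℝ E - 1) * ENNReal.ofReal ‖w‖ := by
  rcases eq_or_ne w 0 with rfl | hw
  · simp
  have hw' : 0 < ‖w‖ := norm_pos_iff.2 hw
  have he : ‖‖w‖⁻¹ • w‖ = 1 := by simp [norm_smul, hw'.ne']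
  rw [← lintegral_sphere_abs_inner_unit he, ← lintegral_mul_const _ (by fun_prop)]
  refine lintegral_congr fun v => ?_
  rw [← ENNReal.ofReal_mul (by positivity), inner_smul_right, abs_mul, abs_inv, abs_norm]
  congr 1
  field_simp

end Sphere

/-! ### Incidence of lines with sets, and measurability of the count. -/

variable {n : ℕ}

namespace OrientedLine

theorem norm_dir (l : OrientedLine n) : ‖l.dir‖ = 1 := norm_eq_of_mem_sphere l.1.1

theorem continuous_dir : Continuous (dir : OrientedLine n → _) := by
  unfold dir; fun_prop

theorem continuous_foot : Continuous (foot : OrientedLine n → _) := by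
  unfold foot; fun_prop

theorem mem_points_iff (l : OrientedLine n) (y : EuclideanSpace ℝ (Fin n)) :
    y ∈ l.points ↔ y - (inner ℝ l.dir y : ℝ) • l.dir = l.foot := by
  have h0 : (inner ℝ l.dir l.foot : ℝ) = 0 := l.2
  constructor
  · rintro ⟨t, rfl⟩
    simp [inner_add_right, inner_smul_right, h0, l.norm_dir]
  · intro h
    exact ⟨inner ℝ l.dir y, by simp [← h]⟩

theorem mem_points_mk'_iff (v : sphere (0 : EuclideanSpace ℝ (Fin n)) 1)
    (p : Perp (v : EuclideanSpace ℝ (Fin n))) (y : EuclideanSpace ℝ (Fin n)) :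
    y ∈ (mk' v p).points ↔ perpProj (v : EuclideanSpace ℝ (Fin n)) y = p := by
  rw [mem_points_iff, ← coe_perpProj (mk' v p).norm_dir]
  exact Subtype.ext_iff.symm

theorem isClosed_mem_points {Y : Type*} [TopologicalSpace Y] {u : Y → EuclideanSpace ℝ (Fin n)}
    (hu : Continuous u) : IsClosed {q : OrientedLine n × Y | u q.2 ∈ q.1.points} := by
  simp only [mem_points_iff]
  have h1 : Continuous fun q : OrientedLine n × Y => q.1.dir := continuous_dir.comp continuous_fst
  have h2 : Continuous fun q : OrientedLine n × Y => q.1.foot := continuous_foot.comp continuous_fst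
  have h3 : Continuous fun q : OrientedLine n × Y => u q.2 := hu.comp continuous_snd
  exact isClosed_eq (by fun_prop) h2

end OrientedLine

theorem isClosed_setOf_exists {X Y : Type*} [TopologicalSpace X] [TopologicalSpace Y]
    [CompactSpace Y] {R : Set (X × Y)} (hR : IsClosed R) : IsClosed {x | ∃ y, (x, y) ∈ R} := by
  convert isClosedMap_fst_of_compactSpace R hR
  ext x
  simp

theorem natCast_le_encard_iff {X : Type*} (s : Set X) (m : ℕ) :
    (m : ℕ∞) ≤ s.encard ↔ ∃ y : Fin m → X, Function.Injective y ∧ ∀ i, y i ∈ s := by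
  constructor
  · intro h
    obtain ⟨t, hts, ht⟩ := exists_subset_encard_eq h
    have hfin : t.Finite := finite_of_encard_eq_coe ht
    have hc : hfin.toFinset.card = m := by
      rw [hfin.encard_eq_coe_toFinset_card] at ht
      exact_mod_cast ht
    refine ⟨fun i => hfin.toFinset.equivFin.symm (Fin.cast hc.symm i), fun i j hij => ?_,
      fun i => hts ?_⟩
    · simpa using Subtype.ext hij
    · exact hfin.mem_toFinset.1 (hfin.toFinset.equivFin.symm (Fin.cast hc.symm i)).2
  · rintro ⟨y, hy, hys⟩
    calc (m : ℕ∞) = ENat.card (Fin m) := by simp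
      _ ≤ (range y).encard := hy.encard_range
      _ ≤ s.encard := encard_le_encard (range_subset_iff.2 hys)

/-- The number of points of a compact set on a line is a measurable function of the line. -/
theorem measurable_encard_points_inter {A : Set (EuclideanSpace ℝ (Fin n))} (hA : IsCompact A) :
    Measurable fun l : OrientedLine n => ((l.points ∩ A).encard : ℝ≥0∞) := by
  have hset : ∀ m : ℕ, MeasurableSet {l : OrientedLine n | (m : ℕ∞) ≤ (l.points ∩ A).encard} := by
    intro m
    have : CompactSpace A := isCompact_iff_compactSpace.1 hA
    -- Distinctness of points is not a closed condition, but separation by `1 / (k + 1)` is.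
    -- Projecting along the compact space of `m`-tuples in `A` then gives a closed set of lines for
    -- each `k`.
    have heq : {l : OrientedLine n | (m : ℕ∞) ≤ (l.points ∩ A).encard} =
        ⋃ k : ℕ, {l | ∃ y : Fin m → A, (l, y) ∈ {q : OrientedLine n × (Fin m → A) |
          (∀ i, (q.2 i : EuclideanSpace ℝ (Fin n)) ∈ q.1.points) ∧
          ∀ i j, i ≠ j → 1 / ((k : ℝ) + 1) ≤ dist (q.2 i) (q.2 j)}} := by
      ext l
      simp only [Set.mem_ofPred_eq, natCast_le_encard_iff, mem_iUnion]
      constructor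
      · rintro ⟨y, hy, hyl⟩
        have hpos : ∀ i j, ∃ ε : ℝ, 0 < ε ∧ (i ≠ j → ε ≤ dist (y i) (y j)) := fun i j => by
          by_cases hij : i = j
          · exact ⟨1, one_pos, fun h => absurd hij h⟩
          · exact ⟨dist (y i) (y j), dist_pos.2 (hy.ne hij), fun _ => le_rfl⟩
        choose ε hε hd using hpos
        obtain ⟨δ, hδ, hδε⟩ : ∃ δ : ℝ, 0 < δ ∧ ∀ q : Fin m × Fin m, δ ≤ ε q.1 q.2 := by
          rcases isEmpty_or_nonempty (Fin m × Fin m) with h | h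
          · exact ⟨1, one_pos, fun q => h.elim q⟩
          · obtain ⟨q0, hq0⟩ := Finite.exists_min fun q : Fin m × Fin m => ε q.1 q.2
            exact ⟨_, hε q0.1 q0.2, hq0⟩
        obtain ⟨k, hk⟩ := exists_nat_one_div_lt hδ
        exact ⟨k, fun i => ⟨y i, (hyl i).2⟩, fun i => (hyl i).1, fun i j hij =>
          hk.le.trans ((hδε (i, j)).trans (hd i j hij))⟩
      · rintro ⟨k, y, hyl, hd⟩
        refine ⟨fun i => y i, fun i j hij => ?_, fun i => ⟨hyl i, (y i).2⟩⟩
        by_contra hne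
        have h1 := hd i j hne
        rw [Subtype.ext hij, dist_self] at h1
        exact absurd h1 (not_le.2 (by positivity))
    rw [heq]
    refine MeasurableSet.iUnion fun k => (isClosed_setOf_exists ?_).measurableSet
    have h1 : IsClosed {q : OrientedLine n × (Fin m → A) |
        ∀ i, (q.2 i : EuclideanSpace ℝ (Fin n)) ∈ q.1.points} := by
      simp only [Set.ofPred_forall]
      exact isClosed_iInter fun i => OrientedLine.isClosed_mem_points
        (u := fun y : Fin m → A => (y i : EuclideanSpace ℝ (Fin n))) (by fun_prop)
    have h2 : IsClosed {q : OrientedLine n × (Fin m → A) |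
        ∀ i j, i ≠ j → 1 / ((k : ℝ) + 1) ≤ dist (q.2 i) (q.2 j)} := by
      simp only [Set.ofPred_forall]
      refine isClosed_iInter fun i => isClosed_iInter fun j => isClosed_iInter fun _ => ?_
      exact isClosed_le (by fun_prop) (by fun_prop)
    exact h1.inter h2
  have hsup : (fun l : OrientedLine n => ((l.points ∩ A).encard : ℝ≥0∞)) =
      fun l => ⨆ m : ℕ, {l : OrientedLine n | (m : ℕ∞) ≤ (l.points ∩ A).encard}.indicator
        (fun _ => (m : ℝ≥0∞)) l := by
    funext l
    refine le_antisymm ?_ (iSup_le fun m => ?_)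
    · generalize hN : (l.points ∩ A).encard = N
      induction N with
      | top =>
        simp only [ENat.toENNReal_top]
        rw [← ENNReal.iSup_natCast]
        refine iSup_mono fun m => ?_
        rw [indicator_of_mem (by simp [hN])]
      | coe k =>
        refine le_iSup_of_le k ?_
        rw [indicator_of_mem (by simp [hN])]
        simp
    · rw [indicator_apply]
      split_ifs with hl
      · rw [← ENat.toENNReal_coe]
        exact ENat.toENNReal_le.2 hl
      · exact zero_le
  rw [hsup]
  exact Measurable.iSup fun m => measurable_const.indicator (hset m)

/-! ### Tangent lines of a single graph. -/

namespace GraphHypersurface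

variable (G : GraphHypersurface n)

/-- The normal vector field of a graph hypersurface. -/
abbrev normal : Perp (G.axis : EuclideanSpace ℝ (Fin n)) → EuclideanSpace ℝ (Fin n) :=
  conormal (G.axis : EuclideanSpace ℝ (Fin n)) G.height

theorem param_eq_graphMap : G.param = graphMap (G.axis : EuclideanSpace ℝ (Fin n)) G.height := rfl

theorem norm_axis : ‖(G.axis : EuclideanSpace ℝ (Fin n))‖ = 1 := norm_eq_of_mem_sphere G.axis

theorem contDiffAt_height {x} (hx : x ∈ G.dom) : ContDiffAt ℝ ∞ G.height x := by
  obtain ⟨U, hU, hdU, hf⟩ := G.smooth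
  exact hf.contDiffAt (hU.mem_nhds (hdU hx))

theorem continuousOn_param : ContinuousOn G.param G.dom := by
  have h : ContinuousOn G.height G.dom := fun x hx =>
    (G.contDiffAt_height hx).continuousAt.continuousWithinAt
  rw [param_eq_graphMap]
  unfold graphMap
  fun_prop

theorem continuousOn_normal : ContinuousOn G.normal G.dom := fun _ hx =>
  (continuousAt_conormal (G.contDiffAt_height hx)).continuousWithinAt

theorem measurableSet_dom : MeasurableSet G.dom := by
  rcases G.isOpen_or_closure with h | ⟨D, -, h⟩
  · exact h.measurableSet
  · rw [h]
    exact isClosed_closure.measurableSet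

/-- Open sets are countable unions of closed sets, and the domain is bounded. Existence of a point
of tangency thus becomes a countable union of conditions over compact sets. -/
theorem exists_iUnion_isCompact_eq_dom :
    ∃ F : ℕ → Set (Perp (G.axis : EuclideanSpace ℝ (Fin n))),
      (∀ k, IsCompact (F k)) ∧ ⋃ k, F k = G.dom := by
  rcases G.isOpen_or_closure with h | ⟨D, -, h⟩
  · obtain ⟨F, hF, hFd, hFu, -⟩ := h.exists_iUnion_isClosed
    exact ⟨F, fun k => isCompact_of_isClosed_isBounded (hF k) (G.isBounded_dom.subset (hFd k)), hFu⟩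
  · refine ⟨fun _ => G.dom, fun _ => isCompact_of_isClosed_isBounded ?_ G.isBounded_dom,
      iUnion_const _⟩
    rw [h]
    exact isClosed_closure

theorem measurableSet_carrier : MeasurableSet G.carrier :=
  G.measurableSet_dom.image_of_continuousOn_injOn G.continuousOn_param
    (graphMap_injective _ _).injOn

/-- The lines which meet the graph in a direction orthogonal to its normal vector. -/
def tangentLines : Set (OrientedLine n) :=
  {l | ∃ x ∈ G.dom, G.param x ∈ l.points ∧ inner ℝ l.dir (G.normal x) = (0 : ℝ)}

/-- The determinant of `sweepDeriv` is nonzero, so it is onto, and each of its values is a tangent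
vector plus a multiple of `v`. -/
theorem span_sup_tangentSpace_eq_top {v : EuclideanSpace ℝ (Fin n)} {x} (hx : x ∈ G.dom)
    (hv : inner ℝ v (G.normal x) ≠ (0 : ℝ)) :
    Submodule.span ℝ {v} ⊔ G.tangentSpace x = ⊤ := by
  have hd : fderiv ℝ G.param x = (Perp (G.axis : EuclideanSpace ℝ (Fin n))).subtypeL +
      (fderiv ℝ G.height x).smulRight (G.axis : EuclideanSpace ℝ (Fin n)) :=
    (hasStrictFDerivAt_graphMap
      ((G.contDiffAt_height hx).hasStrictFDerivAt (by simp))).hasFDerivAt.fderiv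
  rw [normal, ← det_sweepDeriv G.norm_axis] at hv
  rw [eq_top_iff]
  intro y _
  obtain ⟨h, rfl⟩ := (ContinuousLinearMap.toContinuousLinearEquivOfDetNeZero _ hv).surjective y
  change sweepDeriv _ v _ h ∈ _
  rw [sweepDeriv_apply, add_comm]
  refine Submodule.add_mem_sup
    (Submodule.smul_mem _ _ (Submodule.mem_span_singleton_self v)) ?_
  exact ⟨perpProj (G.axis : EuclideanSpace ℝ (Fin n)) h, by rw [hd]; rfl⟩

/-- This implication suffices: it puts the non-transverse lines inside a measurable null set. -/
theorem isTransverse_of_notMem_tangentLines {l : OrientedLine n} (hl : l ∉ G.tangentLines) :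
    G.IsTransverse l := fun x hx hxl =>
  G.span_sup_tangentSpace_eq_top hx fun h => hl ⟨x, hx, hxl, h⟩

theorem measurableSet_tangentLines : MeasurableSet G.tangentLines := by
  obtain ⟨F, hF, hFu⟩ := G.exists_iUnion_isCompact_eq_dom
  have heq : G.tangentLines = ⋃ k, {l | ∃ y : F k, (l, y) ∈ {q : OrientedLine n × F k |
      G.param q.2 ∈ q.1.points ∧ inner ℝ q.1.dir (G.normal q.2) = (0 : ℝ)}} := by
    ext l
    simp only [tangentLines, ← hFu, Set.mem_ofPred_eq, mem_iUnion]
    constructor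
    · rintro ⟨x, ⟨k, hk⟩, h⟩
      exact ⟨k, ⟨x, hk⟩, h⟩
    · rintro ⟨k, ⟨x, hk⟩, h⟩
      exact ⟨x, ⟨k, hk⟩, h⟩
  rw [heq]
  refine MeasurableSet.iUnion fun k => ?_
  have : CompactSpace (F k) := isCompact_iff_compactSpace.1 (hF k)
  have hk : F k ⊆ G.dom := (subset_iUnion F k).trans hFu.subset
  have h1 : Continuous fun y : F k => G.param y :=
    continuousOn_iff_continuous_domRestrict.1 (G.continuousOn_param.mono hk)
  have h2 : Continuous fun q : OrientedLine n × F k => G.normal q.2 :=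
    (continuousOn_iff_continuous_domRestrict.1 (G.continuousOn_normal.mono hk)).comp continuous_snd
  have h3 : Continuous fun q : OrientedLine n × F k => q.1.dir :=
    OrientedLine.continuous_dir.comp continuous_fst
  exact (isClosed_setOf_exists ((OrientedLine.isClosed_mem_points h1).inter
    (isClosed_eq (by fun_prop) continuous_const))).measurableSet

/-- Almost every line is transverse to a graph. -/
theorem kinematicMeasure_tangentLines : kinematicMeasure n G.tangentLines = 0 := by
  have hm := G.measurableSet_tangentLines
  rw [← lintegral_indicator_one hm, lintegral_kinematicMeasure n (measurable_one.indicator hm)]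
  refine lintegral_eq_zero_of_ae_eq_zero (Eventually.of_forall fun v => ?_)
  -- For fixed `v`, the feet of the tangent lines are critical values of the projection to `v^⊥`.
  have h0 := volume_perpProj_graph_eq_zero G.norm_axis (norm_eq_of_mem_sphere v)
    (Z := {x ∈ G.dom | inner ℝ (v : EuclideanSpace ℝ (Fin n)) (G.normal x) = (0 : ℝ)})
    (fun x hx => (G.contDiffAt_height hx).differentiableAt (by simp))
    (fun x hx => hx.1) fun x hx => hx.2
  refine lintegral_eq_zero_of_ae_eq_zero ?_
  filter_upwards [compl_mem_ae_iff.2 h0] with p hp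
  refine indicator_of_notMem ?_ _
  rintro ⟨x, hx, hxl, hxn⟩
  exact hp ⟨x, ⟨hx, hxn⟩, (OrientedLine.mem_points_mk'_iff v p _).1 hxl⟩

end GraphHypersurface

/-! ### Assembling the pieces of a hypersurface. -/

namespace Hypersurface

variable (S : Hypersurface n)

theorem count_ae_eq :
    S.count =ᵐ[kinematicMeasure n] fun l => ((l.points ∩ S.carrier).encard : ℝ≥0∞) := by
  have h : ∀ᵐ l ∂(kinematicMeasure n), ∀ i, l ∉ (S.piece i).tangentLines :=
    ae_all_iff.2 fun i => compl_mem_ae_iff.2 (S.piece i).kinematicMeasure_tangentLines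
  filter_upwards [h] with l hl
  exact if_pos fun i => (S.piece i).isTransverse_of_notMem_tangentLines (hl i)

/-- A hypersurface is a disjoint union of measurable pieces of its graphs. -/
theorem exists_measurable_domains :
    ∃ B : ∀ i, Set (Perp ((S.piece i).axis : EuclideanSpace ℝ (Fin n))),
      (∀ i, MeasurableSet (B i)) ∧ (∀ i, B i ⊆ (S.piece i).dom) ∧
      (∀ i, MeasurableSet ((S.piece i).param '' B i)) ∧
      Pairwise (Function.onFun Disjoint fun i => (S.piece i).param '' B i) ∧
      ⋃ i, (S.piece i).param '' B i = S.carrier := by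
  set C := fun i => (S.piece i).carrier with hC
  have hCm : ∀ i, MeasurableSet (C i) := fun i => (S.piece i).measurableSet_carrier
  have hDm : ∀ i, MeasurableSet (disjointed C i) := fun i => by
    rw [disjointed_apply, Finset.sup_set_eq_biUnion]
    exact (hCm i).diff (Finset.measurableSet_biUnion _ fun j _ => hCm j)
  have hDC : ∀ i, disjointed C i ⊆ C i := fun i => disjointed_subset C i
  -- A subset of a graph is the graph over its own projection, so removing earlier pieces amounts to
  -- shrinking the domain.
  have himg : ∀ i, (S.piece i).param ''
      (perpProj ((S.piece i).axis : EuclideanSpace ℝ (Fin n)) '' disjointed C i) =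
      disjointed C i := by
    intro i
    rw [image_image]
    refine (image_congr fun y hy => ?_).trans (image_id _)
    obtain ⟨x, -, rfl⟩ := hDC i hy
    simp only [GraphHypersurface.param_eq_graphMap, perpProj_graphMap, id]
  refine ⟨fun i => perpProj ((S.piece i).axis : EuclideanSpace ℝ (Fin n)) '' disjointed C i,
    fun i => ?_, fun i => ?_, fun i => ?_, ?_, ?_⟩
  · refine (hDm i).image_of_continuousOn_injOn (by fun_prop) fun y hy y' hy' h => ?_
    obtain ⟨x, -, rfl⟩ := hDC i hy
    obtain ⟨x', -, rfl⟩ := hDC i hy'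
    simp only [GraphHypersurface.param_eq_graphMap, perpProj_graphMap] at h
    rw [h]
  · rintro _ ⟨y, hy, rfl⟩
    obtain ⟨x, hx, rfl⟩ := hDC i hy
    simpa only [GraphHypersurface.param_eq_graphMap, perpProj_graphMap] using hx
  · rw [himg]
    exact hDm i
  · simp only [himg]
    exact disjoint_disjointed C
  · simp only [himg, iUnion_disjointed]
    rfl

/-- The integral of the number of intersection points over the lines of direction `v`. -/
theorem lintegral_encard_direction (v : sphere (0 : EuclideanSpace ℝ (Fin n)) 1)
    {B : ∀ i, Set (Perp ((S.piece i).axis : EuclideanSpace ℝ (Fin n)))}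
    (hB : ∀ i, MeasurableSet (B i)) (hBd : ∀ i, B i ⊆ (S.piece i).dom)
    (hdisj : Pairwise (Function.onFun Disjoint fun i => (S.piece i).param '' B i))
    (hu : ⋃ i, (S.piece i).param '' B i = S.carrier) :
    ∫⁻ p, (((OrientedLine.mk' v p).points ∩ S.carrier).encard : ℝ≥0∞) =
      ∑ i, ∫⁻ x in B i,
        ENNReal.ofReal |inner ℝ (v : EuclideanSpace ℝ (Fin n)) ((S.piece i).normal x)| := by
  have hpiece := fun i => lintegral_encard_perpProj_graph (S.piece i).norm_axis
    (norm_eq_of_mem_sphere v) (fun x hx => (S.piece i).contDiffAt_height hx) (hBd i) (hB i)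
  rw [← Finset.sum_congr rfl fun i _ => (hpiece i).2,
    ← lintegral_finsetSum' _ fun i _ => (hpiece i).1]
  refine lintegral_congr fun p => ?_
  have h1 : ∀ i, (OrientedLine.mk' v p).points ∩ (S.piece i).param '' B i = (S.piece i).param ''
      (B i ∩ (fun x => perpProj (v : EuclideanSpace ℝ (Fin n)) ((S.piece i).param x)) ⁻¹' {p}) := by
    intro i
    ext y
    constructor
    · rintro ⟨hy, x, hx, rfl⟩
      exact ⟨x, ⟨hx, (OrientedLine.mem_points_mk'_iff v p _).1 hy⟩, rfl⟩
    · rintro ⟨x, ⟨hx, hxp⟩, rfl⟩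
      exact ⟨(OrientedLine.mem_points_mk'_iff v p _).2 hxp, x, hx, rfl⟩
  rw [← hu, inter_iUnion, encard_iUnion_of_finite fun i j hij =>
    (hdisj hij).mono inter_subset_right inter_subset_right, finsum_eq_sum_of_fintype]
  rw [← ENat.toENNRealRingHom_apply, map_sum]
  refine Finset.sum_congr rfl fun i _ => ?_
  rw [h1, (show Function.Injective (S.piece i).param from
    graphMap_injective _ _).encard_image]
  rfl

/-- The Cauchy–Crofton formula, for the number of intersection points. -/
theorem lintegral_encard_points_inter (hS : IsCompact S.carrier) :
    ∫⁻ l : OrientedLine n, ((l.points ∩ S.carrier).encard : ℝ≥0∞) ∂(kinematicMeasure n) =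
      2 * ballVolume (n - 1) * S.area := by
  obtain ⟨B, hB, hBd, hBm, hdisj, hu⟩ := S.exists_measurable_domains
  rw [lintegral_kinematicMeasure n (measurable_encard_points_inter hS)]
  simp only [S.lintegral_encard_direction _ hB hBd hdisj hu]
  have hν := fun i => measurable_conormal
    ((S.piece i).axis : EuclideanSpace ℝ (Fin n)) (S.piece i).height
  have hmeas : ∀ i, Measurable (Function.uncurry
      fun (v : sphere (0 : EuclideanSpace ℝ (Fin n)) 1) x =>
        ENNReal.ofReal |inner ℝ (v : EuclideanSpace ℝ (Fin n)) ((S.piece i).normal x)|) := by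
    intro i
    have := hν i
    simp only [Function.uncurry_def]
    fun_prop
  have harea : S.area = ∑ i, ∫⁻ x in B i, ENNReal.ofReal ‖(S.piece i).normal x‖ := by
    rw [area, ← hu, measure_iUnion hdisj hBm, tsum_fintype]
    refine Finset.sum_congr rfl fun i _ => ?_
    have h := euclideanHausdorffMeasure_graph (S.piece i).norm_axis
      (fun x hx => (S.piece i).contDiffAt_height hx) (hBd i) (hB i)
    rwa [finrank_euclideanSpace_fin] at h
  rw [lintegral_finsetSum _ fun i _ => (hmeas i).lintegral_prod_right, harea, Finset.mul_sum]
  refine Finset.sum_congr rfl fun i _ => ?_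
  -- By Tonelli the sphere integral moves inside, where it depends on the normal at `x` only through
  -- its length.
  rw [lintegral_lintegral_swap (hmeas i).aemeasurable]
  have := hν i
  rw [← lintegral_const_mul _ (by fun_prop)]
  refine lintegral_congr fun x => ?_
  rw [lintegral_sphere_abs_inner, finrank_euclideanSpace_fin]

end Hypersurface

end Crofton

end

theorem mainTheorem1 (n : ℕ) (hn : 1 ≤ n) (S : Crofton.Hypersurface n)
    (hS : IsCompact S.carrier) :
    AEMeasurable S.count (Crofton.kinematicMeasure n) ∧
      S.area = (2 * Crofton.ballVolume (n - 1))⁻¹ *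
        ∫⁻ l, S.count l ∂(Crofton.kinematicMeasure n) := by
  -- The unrestricted number of points is Borel measurable; `count` differs from it only on a null
  -- set.
  refine ⟨(Crofton.measurable_encard_points_inter hS).aemeasurable.congr S.count_ae_eq.symm, ?_⟩
  rw [lintegral_congr_ae S.count_ae_eq, S.lintegral_encard_points_inter hS, ← mul_assoc,
    ENNReal.inv_mul_cancel, one_mul]
  · exact mul_ne_zero two_ne_zero (measure_ball_pos _ _ one_pos).ne'
  · exact ENNReal.mul_ne_top ENNReal.ofNat_ne_top measure_ball_lt_top.ne
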